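/- Let $A=(a_1,\dots,a_n)$ be a finite configuration of points of $\mathbb R^d$, possibly repeated or affinely dependent, whose affine span is $\mathbb R^d$. Put $v_i=(a_i,1)\in\mathbb R^{d+1}$ and $Z(V)=\sum_{i=1}^n[0,v_i]$. For disjoint $I,B\subseteq[n]$ such that $(a_b)_{b\in B}$ are $d+1$ affinely independent points, let $\Pi_{I,B}=\sum_{i\in I}v_i+\sum_{b\in B}[0,v_b]$. For $C\subseteq B$ and $J$ disjoint from $C$ with $I\subseteq J\subseteq I\sqcup B$, the parallelepiped $\Pi_{J,C}$ (defined by the same formula) is a face of $\Pi_{I,B}$, with label $(J,C)$. A fine zonotopal tiling $\mathcal P$ of $Z(V)$ is a collection of labelled tiles $\Pi_{I,B}$ whose union is $Z(V)$ and such that any two of them are either disjoint or intersect in a common face, carrying the same label $(J,C)$ in both tiles. For $X\subseteq[n]$ with $|X|=k+d+1$, the spline $M(x\,|\,(a_i)_{i\in X})$ of degree $k$ is defined as follows. It is $0$ if no $d+1$ of the points $(a_i)_{i\in X}$ are affinely independent. Otherwise, it is $\frac{d!}{\det(X)}\mathbf 1_{\mathrm{ch}(\{a_i\}_{i\in X})}(x)$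 if $k=0$, and if $k\ge1$ it is $$\frac{k+d}{k}\sum_{b\in B}\frac{\det(B;b\to x)}{\det(B)}\,M(x\,|\,(a_i)_{i\in X\setminus\{b\}}),$$ where $B=B(X)\subseteq X$ is any choice of $d+1$ indices with affinely independent points. Here $\det(B)=\det((a_b,1)_{b\in B})$ with the rows ordered so that it is positive, and in $\det(B;b\to x)$ the row $(a_b,1)$ is replaced by $(x,1)$. Let $K\subset\mathbb R^d$ be the union of the convex hulls of all subconfigurations of at most $d$ points of $A$ (the knots). Let $k\ge0$, let $\mathcal P$ be any fine zonotopal tiling of $Z(V)$, and assume that each vertex of $\mathrm{ch}(A)$ is repeated at least $k+1$ times in $A$. Then the splines $M(\cdot\,|\,(a_i)_{i\in I\sqcup B})$, for $\Pi_{I,B}\in\mathcal P$ with $|I|=k$, reproduce polynomials of degree at most $k$ on the whole of $\mathrm{ch}(A)$. Precisely, $K$ has Lebesgue measure zero and $\mathrm{ch}(A)\setminus K$ is dense in $\mathrm{ch}(A)$. Moreover, every real polynomial $q$ in $d$ variables of degree at most $k$ has a polar form $Q$ (a function of $k$ points of $\mathbb R^d$ that is symmetric, affine in each argument, and satisfies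 $Q(x,\dots,x)=q(x)$) such that $$q(x)=\frac{k!}{(k+d)!}\sum_{\Pi_{I,B}\in\mathcal P,\ |I|=k}Q((a_i)_{i\in I})\,\mathrm{vol}^{d+1}(\Pi_{I,B})\,M(x\,|\,(a_i)_{i\in I\sqcup B})\qquad\text{for all }x\in\mathrm{ch}(A)\setminus K,$$ and at every point $x\in\mathrm{ch}(A)$, boundary and knots included, the right-hand side, evaluated at points of $\mathrm{ch}(A)\setminus K$ tending to $x$, tends to $q(x)$. -/

import Mathlib

open scoped Pointwise

/-- The projective lift `(a, 1) ∈ ℝ^{d+1}` of a point `a ∈ ℝ^d`. -/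
def projLift {d : ℕ} (p : Fin d → ℝ) : Fin (d + 1) → ℝ :=
  Fin.snoc (α := fun _ => ℝ) p 1

/-- The points `(a_b)_{b ∈ B}` are `d + 1` affinely independent points of `ℝ^d`. -/
def IsAffBasis {d n : ℕ} (a : Fin n → Fin d → ℝ) (B : Finset (Fin n)) : Prop :=
  B.card = d + 1 ∧ AffineIndependent ℝ (fun b : B => a b)

/-- The determinant of the rows `(a_b, 1)`, `b ∈ B`, taken in increasing order of `b`
(only used for `|B| = d + 1`). -/
noncomputable def rowDet {d n : ℕ} (a : Fin n → Fin d → ℝ) (B : Finset (Fin n)) : ℝ :=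
  if h : B.card = d + 1 then
    Matrix.det (Matrix.of fun j : Fin (d + 1) => projLift (a (B.orderEmbOfFin h j)))
  else 0

/-- The determinant of the rows `(a_b, 1)`, `b ∈ B`, ordered so that it is positive. -/
noncomputable def detPos {d n : ℕ} (a : Fin n → Fin d → ℝ) (B : Finset (Fin n)) : ℝ :=
  |rowDet a B|

/-- The result of replacing the row `(a_b, 1)` by `(x, 1)` in the determinant `detPos a B`, all rows
keeping the order that makes `detPos a B` positive. -/
noncomputable def detReplace {d n : ℕ} (a : Fin n → Fin d → ℝ) (B : Finset (Fin n)) (b : Fin n)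
    (x : Fin d → ℝ) : ℝ :=
  Real.sign (rowDet a B) * rowDet (Function.update a b x) B

/-- `β` selects, from each index set `X` whose points affinely span `ℝ^d`, a subset `β X` indexing
`d + 1` affinely independent points. -/
def IsBasisChoice {d n : ℕ} (a : Fin n → Fin d → ℝ) (β : Finset (Fin n) → Finset (Fin n)) : Prop :=
  ∀ X : Finset (Fin n), (∃ B ⊆ X, IsAffBasis a B) → β X ⊆ X ∧ IsAffBasis a (β X)

open Classical in
/-- The normalized multivariate spline `M(x | (a_i)_{i ∈ X})` of degree `k`, where `|X| = k + d + 1`,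
given by its recurrence; `β X` is the subset `B ⊆ X` used in the recurrence at `X`. -/
noncomputable def simplexSpline {d n : ℕ} (a : Fin n → Fin d → ℝ)
    (β : Finset (Fin n) → Finset (Fin n)) : ℕ → Finset (Fin n) → (Fin d → ℝ) → ℝ
  | 0, X, x =>
    if IsAffBasis a X then
      (d.factorial : ℝ) / detPos a X *
        Set.indicator (convexHull ℝ (a '' (X : Set (Fin n)))) (fun _ => (1 : ℝ)) x
    else 0
  | k + 1, X, x =>
    if ∃ B ⊆ X, IsAffBasis a B then
      (((k + 1 : ℕ) : ℝ) + d) / ((k + 1 : ℕ) : ℝ) *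
        ∑ b ∈ β X, detReplace a (β X) b x / detPos a (β X) * simplexSpline a β k (X.erase b) x
    else 0

/-- The zonotope `Z(V) = ∑_i [0, v_i]` of the lifted configuration `v_i = (a_i, 1)`. -/
def zonotope {d n : ℕ} (a : Fin n → Fin d → ℝ) : Set (Fin (d + 1) → ℝ) :=
  ∑ i : Fin n, segment ℝ 0 (projLift (a i))

/-- `Π_{I,B} = ∑_{i ∈ I} v_i + ∑_{b ∈ B} [0, v_b]`. -/
def tileSet {d n : ℕ} (a : Fin n → Fin d → ℝ) (I B : Finset (Fin n)) : Set (Fin (d + 1) → ℝ) :=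
  {∑ i ∈ I, projLift (a i)} + ∑ b ∈ B, segment ℝ 0 (projLift (a b))

/-- `Π_{J,C}` is one of the faces of `Π_{I,B}`: for `b ∈ B \ C` the coefficient of `v_b` is set to
`1` if `b ∈ J` and to `0` if `b ∉ J`. -/
def IsTileFace {n : ℕ} (J C I B : Finset (Fin n)) : Prop :=
  C ⊆ B ∧ I ⊆ J ∧ J ⊆ I ∪ B ∧ Disjoint J C

/-- A fine zonotopal tiling of `Z(V)`. Tiles and faces carry their labels `(I, B)`: different index
sets may describe the same subset of `ℝ^{d+1}`, so a common face has to be a face of both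
tiles with the same label. -/
structure IsFineZonotopalTiling {d n : ℕ} (a : Fin n → Fin d → ℝ)
    (P : Finset (Finset (Fin n) × Finset (Fin n))) : Prop where
  tile : ∀ t ∈ P, Disjoint t.1 t.2 ∧ IsAffBasis a t.2
  cover : (⋃ t ∈ P, tileSet a t.1 t.2) = zonotope a
  inter : ∀ s ∈ P, ∀ t ∈ P, (tileSet a s.1 s.2 ∩ tileSet a t.1 t.2).Nonempty →
    ∃ J C : Finset (Fin n), IsTileFace J C s.1 s.2 ∧ IsTileFace J C t.1 t.2 ∧
      tileSet a s.1 s.2 ∩ tileSet a t.1 t.2 = tileSet a J C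

/-- `Q` is the polar form of `q`, as a polynomial of degree at most `k`: symmetric, affine in each
of its `k` arguments, and equal to `q` on the diagonal. -/
structure IsPolarForm {d : ℕ} (k : ℕ) (q : MvPolynomial (Fin d) ℝ)
    (Q : (Fin k → Fin d → ℝ) → ℝ) : Prop where
  symm : ∀ (σ : Equiv.Perm (Fin k)) (p : Fin k → Fin d → ℝ), Q (p ∘ σ) = Q p
  affine : ∀ (p : Fin k → Fin d → ℝ) (j : Fin k) (y z : Fin d → ℝ) (s : ℝ),
    Q (Function.update p j ((1 - s) • y + s • z)) =
      (1 - s) * Q (Function.update p j y) + s * Q (Function.update p j z)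
  diag : ∀ x : Fin d → ℝ, Q (fun _ => x) = MvPolynomial.eval x q

/-- `Q((a_i)_{i ∈ I})` for an index set `I` of size `k` (the value `0` for other `I` is not used). -/
noncomputable def polarAt {d n k : ℕ} (Q : (Fin k → Fin d → ℝ) → ℝ) (a : Fin n → Fin d → ℝ)
    (I : Finset (Fin n)) : ℝ :=
  if h : I.card = k then Q (fun j => a (I.orderEmbOfFin h j)) else 0

/-- The convex hull `ch(A)` of all points. -/
def hull {d n : ℕ} (a : Fin n → Fin d → ℝ) : Set (Fin d → ℝ) :=
  convexHull ℝ (Set.range a)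

/-- The knot set: the union of the convex hulls of at most `d` of the points. Off this set
the value of a spline does not depend on the subsets `B` used in its recurrence. -/
def knotSet {d n : ℕ} (a : Fin n → Fin d → ℝ) : Set (Fin d → ℝ) :=
  ⋃ C : {C : Finset (Fin n) // C.card ≤ d}, convexHull ℝ (a '' (C.1 : Set (Fin n)))

/-- The combination
`k!/(k+d)! ∑_{Π_{I,B} ∈ P, |I| = k} Q((a_i)_{i ∈ I}) vol(Π_{I,B}) M(x | (a_i)_{i ∈ I ⊔ B})`. -/
noncomputable def tileSplineSum {d n : ℕ} (a : Fin n → Fin d → ℝ)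
    (β : Finset (Fin n) → Finset (Fin n)) (P : Finset (Finset (Fin n) × Finset (Fin n))) (k : ℕ)
    (Q : (Fin k → Fin d → ℝ) → ℝ) (x : Fin d → ℝ) : ℝ :=
  (k.factorial : ℝ) / ((k + d).factorial : ℝ) *
    ∑ t ∈ P.filter (fun t => t.1.card = k),
      polarAt Q a t.1 * MeasureTheory.volume.real (tileSet a t.1 t.2) *
        simplexSpline a β k (t.1 ∪ t.2) x

/-! ### Barycentric coordinates as linear algebra on the lifts -/

section Lift
variable {d n : ℕ}

/-! Off the knots the identity is proved by induction on `k`, for an arbitrary symmetric multiaffine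
`Q` (`IsFineZonotopalTiling.tileSplineSum_eq`). For `k = 0`, the tiles with `I = ∅`, cut at height
1/2, triangulate ch(A), so exactly one simplex contains `x`, and the volume of its tile cancels the
determinant in its spline.

For the step let U_C be the functional y ↦ det(v_c, y) of a facet (J, C). Fix one argument of `Q` at
`x` and apply the case `k` to the others. Expanding Q(x, a_I) in the barycentric coordinates of `x`
in `B` turns that case into a sum over the facets (I ∪ {b}, B \ {b}) of the tiles with |I| = k.
Expanding the splines of degree `k + 1` by their recurrence turns the case `k + 1` into a sum over
the facets (I, B \ {b}) of the tiles with |I| = k + 1. By Cramer's rule every term has the form G(J,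
C) sign U_C(v_b), where |J| = k + 1 and G(J, C) = Q(a_J) M(x | J ∪ C) U_C(x) does not depend on the
tile.

The two sums agree facet by facet. If the zonotope continues on both sides of the facet, there is
exactly one tile on each side and the terms match. Otherwise the repetition of the vertices of ch(A)
forces all points of J ∪ C into one hyperplane, and the spline vanishes
(`IsFineZonotopalTiling.not_exists_basis_of_sum_ne_zero`).

The recurrence must be usable with the tile's own `B` instead of the prescribed choice. This is
`simplexSpline_succ_eq`: affine relations among the points are relations among the splines
(`sum_mul_simplexSpline_erase`), which reduces to counting the simplices of a circuit that contain
`x`.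

Polar forms arise by symmetrization, and the limit at the remaining points is continuity of `q`. -/

@[simp] lemma projLift_last (p : Fin d → ℝ) : projLift p (Fin.last d) = 1 := by
  simp [projLift]

@[simp] lemma projLift_castSucc (p : Fin d → ℝ) (j : Fin d) : projLift p j.castSucc = p j := by
  simp [projLift]

lemma sum_smul_projLift_eq_iff {ι : Type*} (s : Finset ι) (c : ι → ℝ) (p : ι → Fin d → ℝ)
    (y : Fin (d + 1) → ℝ) :
    ∑ i ∈ s, c i • projLift (p i) = y ↔
      ∑ i ∈ s, c i • p i = (fun j => y j.castSucc) ∧ ∑ i ∈ s, c i = y (Fin.last d) := by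
  constructor
  · rintro rfl
    exact ⟨by ext j; simp, by simp⟩
  · rintro ⟨h1, h2⟩
    ext j
    refine Fin.lastCases ?_ (fun j => ?_) j
    · simpa using h2
    · simpa using congrFun h1 j

lemma sum_smul_projLift_eq_projLift_iff {ι : Type*} (s : Finset ι) (c : ι → ℝ)
    (p : ι → Fin d → ℝ) (x : Fin d → ℝ) :
    ∑ i ∈ s, c i • projLift (p i) = projLift x ↔
      ∑ i ∈ s, c i • p i = x ∧ ∑ i ∈ s, c i = 1 := by
  rw [sum_smul_projLift_eq_iff]
  simp

lemma sum_univ_eq_sum_of_zero_off {M : Type*} [AddCommMonoid M] [Module ℝ M] {X : Finset (Fin n)}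
    {c : Fin n → ℝ} (hc : ∀ i ∉ X, c i = 0) (f : Fin n → M) :
    ∑ i, c i • f i = ∑ i ∈ X, c i • f i :=
  (Finset.sum_subset (Finset.subset_univ X) fun i _ hi => by simp [hc i hi]).symm

/-- Weights live on the whole index set and vanish off `X`, so that representations over different
subsets can be subtracted directly. Working with indices keeps repeated points apart. -/
lemma mem_convexHull_image_iff (a : Fin n → Fin d → ℝ) (X : Finset (Fin n)) (x : Fin d → ℝ) :
    x ∈ convexHull ℝ (a '' (X : Set (Fin n))) ↔
      ∃ c : Fin n → ℝ, (∀ i, 0 ≤ c i) ∧ (∀ i ∉ X, c i = 0) ∧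
        ∑ i, c i • projLift (a i) = projLift x := by
  classical
  constructor
  · intro hx
    have hr : a '' (X : Set (Fin n)) = Set.range (fun i : X => a i) := by
      ext; simp
    rw [hr, convexHull_range_eq_exists_affineCombination] at hx
    obtain ⟨s, w, hw0, hw1, rfl⟩ := hx
    rw [Finset.affineCombination_eq_linear_combination _ _ _ hw1]
    refine ⟨fun i => if h : i ∈ X then (if ⟨i, h⟩ ∈ s then w ⟨i, h⟩ else 0) else 0, ?_, ?_, ?_⟩
    · intro i
      dsimp only
      split_ifs with h h'
      · exact hw0 _ h'
      all_goals exact le_rfl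
    · intro i hi
      simp [hi]
    · rw [sum_univ_eq_sum_of_zero_off (X := X) (fun i hi => by simp [hi]),
        ← Finset.sum_coe_sort X, sum_smul_projLift_eq_projLift_iff]
      have hs : X.attach ∩ s = s := Finset.inter_eq_right.2 fun i _ => Finset.mem_attach _ _
      simp [Finset.sum_ite_mem, hs, hw1, ite_smul]
  · rintro ⟨c, h0, hX, hc⟩
    rw [sum_univ_eq_sum_of_zero_off hX, sum_smul_projLift_eq_projLift_iff] at hc
    rw [← hc.1]
    exact (convex_convexHull ℝ _).sum_mem (fun i _ => h0 i) hc.2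
      (fun i hi => subset_convexHull ℝ _ ⟨i, hi, rfl⟩)

lemma mem_hull_iff (a : Fin n → Fin d → ℝ) (x : Fin d → ℝ) :
    x ∈ hull a ↔ ∃ c : Fin n → ℝ, (∀ i, 0 ≤ c i) ∧ ∑ i, c i • projLift (a i) = projLift x := by
  have := mem_convexHull_image_iff a Finset.univ x
  simpa [hull] using this

lemma card_lt_of_notMem_knotSet {a : Fin n → Fin d → ℝ} {x : Fin d → ℝ} (hx : x ∉ knotSet a)
    {X : Finset (Fin n)} (h : x ∈ convexHull ℝ (a '' (X : Set (Fin n)))) : d < X.card := by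
  by_contra hX
  exact hx (Set.mem_iUnion.2 ⟨⟨X, not_lt.1 hX⟩, h⟩)

/-- Off the knots, a nonnegative representation by `d + 1` of the points has positive weights. -/
lemma pos_of_notMem_knotSet {a : Fin n → Fin d → ℝ} {x : Fin d → ℝ} (hx : x ∉ knotSet a)
    {B : Finset (Fin n)} (hB : B.card = d + 1) {c : Fin n → ℝ} (h0 : ∀ i, 0 ≤ c i)
    (hc : ∀ i ∉ B, c i = 0) (hcx : ∑ i, c i • projLift (a i) = projLift x) {b : Fin n}
    (hb : b ∈ B) : 0 < c b := by
  classical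
  refine lt_of_le_of_ne (h0 b) fun h => ?_
  have := card_lt_of_notMem_knotSet hx (X := B.erase b)
    ((mem_convexHull_image_iff a _ x).2 ⟨c, h0, fun i hi => ?_, hcx⟩)
  · rw [Finset.card_erase_of_mem hb] at this
    omega
  · by_cases hib : i = b
    · rw [hib, ← h]
    · exact hc i fun h' => hi (Finset.mem_erase.2 ⟨hib, h'⟩)

lemma isAffBasis_iff (a : Fin n → Fin d → ℝ) (B : Finset (Fin n)) :
    IsAffBasis a B ↔ B.card = d + 1 ∧ LinearIndependent ℝ (fun b : B => projLift (a b)) := by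
  refine and_congr_right fun _ => ?_
  rw [affineIndependent_iff, linearIndependent_iff']
  refine forall_congr' fun s => forall_congr' fun w => ?_
  rw [sum_smul_projLift_eq_iff]
  constructor
  · exact fun h h' => h h'.2 h'.1
  · exact fun h h1 h2 => h ⟨h2, h1⟩

lemma IsAffBasis.eq_zero {a : Fin n → Fin d → ℝ} {B : Finset (Fin n)} (hB : IsAffBasis a B)
    {c : Fin n → ℝ} (hc : ∀ i ∉ B, c i = 0) (h : ∑ i, c i • projLift (a i) = 0) : c = 0 := by
  rw [isAffBasis_iff] at hB
  rw [sum_univ_eq_sum_of_zero_off hc, ← Finset.sum_coe_sort] at h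
  have := Fintype.linearIndependent_iff.1 hB.2 (fun b => c b) h
  ext i
  by_cases hi : i ∈ B
  · exact this ⟨i, hi⟩
  · exact hc i hi

lemma IsAffBasis.coord_unique {a : Fin n → Fin d → ℝ} {B : Finset (Fin n)} (hB : IsAffBasis a B)
    {c c' : Fin n → ℝ} (hc : ∀ i ∉ B, c i = c' i)
    (h : ∑ i, c i • projLift (a i) = ∑ i, c' i • projLift (a i)) : c = c' := by
  have := hB.eq_zero (c := c - c') (fun i hi => by simp [hc i hi])
    (by simp [sub_smul, Finset.sum_sub_distrib, h])
  exact sub_eq_zero.1 this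

lemma IsAffBasis.exists_coord {a : Fin n → Fin d → ℝ} {B : Finset (Fin n)} (hB : IsAffBasis a B)
    (y : Fin (d + 1) → ℝ) :
    ∃ c : Fin n → ℝ, (∀ i ∉ B, c i = 0) ∧ ∑ i, c i • projLift (a i) = y := by
  classical
  rw [isAffBasis_iff] at hB
  have hs := hB.2.span_eq_top_of_card_eq_finrank' (by simp [hB.1])
  have hy : y ∈ Submodule.span ℝ (Set.range fun b : B => projLift (a b)) := hs ▸ Submodule.mem_top
  obtain ⟨w, rfl⟩ := (Submodule.mem_span_range_iff_exists_fun ℝ).1 hy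
  refine ⟨fun i => if h : i ∈ B then w ⟨i, h⟩ else 0, fun i hi => by simp [hi], ?_⟩
  rw [sum_univ_eq_sum_of_zero_off (X := B) (fun i hi => by simp [hi]), ← Finset.sum_coe_sort]
  simp

end Lift

/-! ### Determinants, facet functionals and Cramer's rule -/

section Det
variable {d n : ℕ}

lemma exists_perm_orderEmbOfFin {m : ℕ} {B : Finset (Fin n)} (hB : B.card = m) (e : Fin m → Fin n)
    (he : Function.Injective e) (heB : ∀ j, e j ∈ B) :
    ∃ σ : Equiv.Perm (Fin m), ∀ j, B.orderEmbOfFin hB (σ j) = e j := by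
  let f : Fin m → Fin m := fun j => (B.orderIsoOfFin hB).symm ⟨e j, heB j⟩
  have hf : Function.Injective f := fun i j h => he (by simpa [f] using h)
  exact ⟨Equiv.ofBijective f (Finite.injective_iff_bijective.1 hf), fun j => by
    simp [f, ← Finset.coe_orderIsoOfFin_apply]⟩

/-- `ε` is the sign of the reordering permutation. It is chosen before `a`, so one sign serves both
a configuration and the same configuration with a point replaced. -/
lemma exists_rowDet_eq (B : Finset (Fin n)) (hB : B.card = d + 1) (e : Fin (d + 1) → Fin n)
    (he : Function.Injective e) (heB : ∀ j, e j ∈ B) :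
    ∃ ε : ℝ, (ε = 1 ∨ ε = -1) ∧ ∀ a : Fin n → Fin d → ℝ,
      rowDet a B = ε * Matrix.det (Matrix.of fun j => projLift (a (e j))) := by
  classical
  obtain ⟨σ, hσ⟩ := exists_perm_orderEmbOfFin hB e he heB
  refine ⟨((Equiv.Perm.sign σ : ℤ) : ℝ), ?_, fun a => ?_⟩
  · rcases Int.units_eq_one_or (Equiv.Perm.sign σ) with h | h <;> simp [h]
  · have h1 := Matrix.det_permute σ
      (Matrix.of fun j : Fin (d + 1) => projLift (a (B.orderEmbOfFin hB j)))
    have h2 : (Matrix.of fun j : Fin (d + 1) =>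
        projLift (a (B.orderEmbOfFin hB j))).submatrix σ id =
        Matrix.of fun j => projLift (a (e j)) := by
      ext i j
      simp [hσ]
    rw [rowDet, dif_pos hB, ← h2, h1, ← mul_assoc, ← Int.cast_mul, ← Units.val_mul]
    simp

lemma rowDet_ne_zero_iff (a : Fin n → Fin d → ℝ) (B : Finset (Fin n)) :
    rowDet a B ≠ 0 ↔ IsAffBasis a B := by
  classical
  rw [isAffBasis_iff]
  by_cases hB : B.card = d + 1
  · rw [rowDet, dif_pos hB, ← isUnit_iff_ne_zero, ← Matrix.isUnit_iff_isUnit_det,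
      ← Matrix.linearIndependent_rows_iff_isUnit]
    simp only [hB, true_and]
    rw [← linearIndependent_equiv (B.orderIsoOfFin hB).toEquiv]
    rfl
  · simp [rowDet, hB]

lemma detPos_pos {a : Fin n → Fin d → ℝ} {B : Finset (Fin n)} (hB : IsAffBasis a B) :
    0 < detPos a B := abs_pos.2 ((rowDet_ne_zero_iff a B).2 hB)

/-- The linear functional `y ↦ det (v_c, y)` vanishing on the hyperplane spanned by the lifts of
the `d` points indexed by `C`. -/
noncomputable def facetFunctional (a : Fin n → Fin d → ℝ) (C : Finset (Fin n)) :
    (Fin (d + 1) → ℝ) →ₗ[ℝ] ℝ :=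
  if h : C.card = d then
    (Matrix.detRowAlternating (R := ℝ) (n := Fin (d + 1))).toMultilinearMap.toLinearMap
      (Fin.snoc (α := fun _ => Fin (d + 1) → ℝ) (fun j => projLift (a (C.orderEmbOfFin h j))) 0)
      (Fin.last d)
  else 0

lemma facetFunctional_apply (a : Fin n → Fin d → ℝ) {C : Finset (Fin n)} (h : C.card = d)
    (y : Fin (d + 1) → ℝ) :
    facetFunctional a C y = Matrix.det (Matrix.of (Fin.snoc (α := fun _ => Fin (d + 1) → ℝ)
      (fun j => projLift (a (C.orderEmbOfFin h j))) y)) := by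
  rw [facetFunctional, dif_pos h]
  simp only [MultilinearMap.toLinearMap_apply, Fin.update_snoc_last]
  rfl

lemma facetFunctional_of_mem (a : Fin n → Fin d → ℝ) {C : Finset (Fin n)} (h : C.card = d)
    {c : Fin n} (hc : c ∈ C) : facetFunctional a C (projLift (a c)) = 0 := by
  classical
  rw [facetFunctional_apply a h]
  obtain ⟨j, hj⟩ : ∃ j, C.orderEmbOfFin h j = c := by
    have : c ∈ Set.range (C.orderEmbOfFin h) := by simpa using hc
    exact this
  refine Matrix.det_zero_of_row_eq (i := j.castSucc) (j := Fin.last d)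
    (Fin.castSucc_lt_last j).ne ?_
  ext i
  simp [hj]

lemma exists_rowDet_insert (C : Finset (Fin n)) (h : C.card = d) {b : Fin n} (hb : b ∉ C) :
    ∃ ε : ℝ, (ε = 1 ∨ ε = -1) ∧ ∀ a : Fin n → Fin d → ℝ,
      (rowDet a (insert b C) = ε * facetFunctional a C (projLift (a b))) ∧
      ∀ x, rowDet (Function.update a b x) (insert b C) =
        ε * facetFunctional a C (projLift x) := by
  classical
  have hmem : ∀ j, C.orderEmbOfFin h j ∈ C := fun j => C.orderEmbOfFin_mem h j
  obtain ⟨ε, hε, H⟩ := exists_rowDet_eq (d := d) (insert b C)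
    (by rw [Finset.card_insert_of_notMem hb, h])
    (Fin.snoc (α := fun _ => Fin n) (C.orderEmbOfFin h) b)
    (Fin.snoc_injective_iff.2 ⟨(C.orderEmbOfFin h).injective, fun ⟨j, hj⟩ => hb (hj ▸ hmem j)⟩)
    (fun j => by
      refine Fin.lastCases ?_ (fun j => ?_) j
      · simp
      · simp [hmem])
  have key : ∀ (a a' : Fin n → Fin d → ℝ), (∀ c ∈ C, a' c = a c) →
      rowDet a' (insert b C) = ε * facetFunctional a C (projLift (a' b)) := by
    intro a a' haa
    rw [H, facetFunctional_apply a h]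
    congr 3
    ext j i
    refine Fin.lastCases ?_ (fun j => ?_) j
    · simp
    · simp [haa _ (hmem j)]
  refine ⟨ε, hε, fun a => ⟨key a a fun _ _ => rfl, fun x => ?_⟩⟩
  rw [key a _ fun c hc => Function.update_of_ne (ne_of_mem_of_not_mem hc hb) _ _]
  simp

lemma detPos_insert (a : Fin n → Fin d → ℝ) {C : Finset (Fin n)} (h : C.card = d) {b : Fin n}
    (hb : b ∉ C) : detPos a (insert b C) = |facetFunctional a C (projLift (a b))| := by
  obtain ⟨ε, hε, H⟩ := exists_rowDet_insert C h hb
  rw [detPos, (H a).1]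
  rcases hε with rfl | rfl <;> simp

/-- The generator `b` enters only through a sign, and the factor containing `x` belongs to the facet
`C` alone. This allows the contributions of neighbouring tiles to be compared. The reordering sign
occurs twice and drops out. -/
lemma detReplace_insert (a : Fin n → Fin d → ℝ) {C : Finset (Fin n)} (h : C.card = d) {b : Fin n}
    (hb : b ∉ C) (x : Fin d → ℝ) : detReplace a (insert b C) b x =
      Real.sign (facetFunctional a C (projLift (a b))) * facetFunctional a C (projLift x) := by
  obtain ⟨ε, hε, H⟩ := exists_rowDet_insert C h hb
  rw [detReplace, (H a).1, (H a).2]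
  rcases hε with rfl | rfl <;> simp [Real.sign_neg]

lemma facetFunctional_ne_zero_iff (a : Fin n → Fin d → ℝ) {C : Finset (Fin n)} (h : C.card = d)
    {b : Fin n} (hb : b ∉ C) :
    facetFunctional a C (projLift (a b)) ≠ 0 ↔ IsAffBasis a (insert b C) := by
  rw [← rowDet_ne_zero_iff, ← abs_pos, ← detPos_insert a h hb, detPos, abs_pos]

lemma facetFunctional_sum (a : Fin n → Fin d → ℝ) {C : Finset (Fin n)} (h : C.card = d)
    {c : Fin n → ℝ} {b : Fin n} (hc : ∀ i ∉ insert b C, c i = 0) :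
    facetFunctional a C (∑ i, c i • projLift (a i)) =
      c b * facetFunctional a C (projLift (a b)) := by
  rw [map_sum, Finset.sum_eq_single b]
  · simp
  · intro i _ hib
    by_cases hi : i ∈ C
    · simp [facetFunctional_of_mem a h hi]
    · simp [hc i (by simp [hib, hi])]
  · simp

/-- Cramer's rule. -/
lemma IsAffBasis.detReplace_eq {a : Fin n → Fin d → ℝ} {B : Finset (Fin n)} (hB : IsAffBasis a B)
    {c : Fin n → ℝ} (hc : ∀ i ∉ B, c i = 0) {x : Fin d → ℝ}
    (h : ∑ i, c i • projLift (a i) = projLift x) {b : Fin n} (hb : b ∈ B) :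
    detReplace a B b x = c b * detPos a B := by
  classical
  have hins : insert b (B.erase b) = B := Finset.insert_erase hb
  have hcard : (B.erase b).card = d := by rw [Finset.card_erase_of_mem hb, hB.1]; rfl
  have h1 := detReplace_insert a hcard (Finset.notMem_erase b B) x
  have h2 := detPos_insert a hcard (Finset.notMem_erase b B)
  rw [← h, facetFunctional_sum a hcard (b := b) (by rwa [hins])] at h1
  rw [hins] at h1 h2
  have h3 : ∀ r : ℝ, Real.sign r * r = |r| := fun r => by
    rcases lt_trichotomy r 0 with h | h | h
    · rw [Real.sign_of_neg h, abs_of_neg h]; ring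
    · simp [h]
    · rw [Real.sign_of_pos h, abs_of_pos h]; ring
  rw [h1, h2, mul_left_comm, h3]

lemma IsAffBasis.detReplace_div {a : Fin n → Fin d → ℝ} {B : Finset (Fin n)} (hB : IsAffBasis a B)
    {c : Fin n → ℝ} (hc : ∀ i ∉ B, c i = 0) {x : Fin d → ℝ}
    (h : ∑ i, c i • projLift (a i) = projLift x) {b : Fin n} (hb : b ∈ B) :
    detReplace a B b x / detPos a B = c b := by
  rw [hB.detReplace_eq hc h hb, mul_div_cancel_right₀ _ (detPos_pos hB).ne']

end Det

/-! ### Independence of the spline recurrence from the chosen basis -/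

section Spline
variable {d n : ℕ}

/-- Signs `±1`, each taken at most once and occurring only in pairs, sum to zero. -/
lemma sum_eq_zero_of_signs {ι : Type*} (S : Finset ι) (η : ι → ℝ)
    (h1 : ∀ i ∈ S, η i ≠ 0) (hinj : ∀ i ∈ S, ∀ j ∈ S, η i = η j → i = j)
    (hneg : ∀ i ∈ S, ∃ j ∈ S, η j = -η i) : ∑ i ∈ S, η i = 0 := by
  choose! g hgS hg using hneg
  refine Finset.sum_involution (fun i _ => g i) (fun i hi => by rw [hg i hi]; ring)
    (fun i hi _ h => h1 i hi ?_) (fun i hi => hgS i hi) (fun i hi => ?_)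
  · have := hg i hi
    rw [h] at this
    linarith
  · exact hinj _ (hgS _ (hgS i hi)) _ hi (by rw [hg _ (hgS i hi), hg i hi, neg_neg])

lemma simplexSpline_eq_zero (a : Fin n → Fin d → ℝ) (β : Finset (Fin n) → Finset (Fin n)) (k : ℕ)
    {X : Finset (Fin n)} (hX : ¬ ∃ B ⊆ X, IsAffBasis a B) (x : Fin d → ℝ) :
    simplexSpline a β k X x = 0 := by
  cases k with
  | zero => rw [simplexSpline, if_neg fun h => hX ⟨X, subset_rfl, h⟩]
  | succ k => rw [simplexSpline, if_neg hX]

/-- Moving along an affine relation until a weight vanishes. -/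
lemma exists_mem_convexHull_erase {a : Fin n → Fin d → ℝ} {X : Finset (Fin n)} {x : Fin d → ℝ}
    (hx : x ∈ convexHull ℝ (a '' (X : Set (Fin n)))) {μ : Fin n → ℝ} (hμX : ∀ i ∉ X, μ i = 0)
    (hμ : ∑ i, μ i • projLift (a i) = 0) {i : Fin n} (hi : 0 < μ i) :
    ∃ j ∈ X, μ j < 0 ∧ x ∈ convexHull ℝ (a '' (X.erase j : Set (Fin n))) := by
  classical
  obtain ⟨c, c0, cX, cx⟩ := (mem_convexHull_image_iff a X x).1 hx
  have hsum : ∑ i, μ i = 0 := by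
    have := congrFun hμ (Fin.last d)
    simpa using this
  have hne : (Finset.univ.filter fun j => μ j < 0).Nonempty := by
    by_contra h
    rw [Finset.not_nonempty_iff_eq_empty, Finset.filter_eq_empty_iff] at h
    have h0 : ∀ j ∈ Finset.univ, 0 ≤ μ j := fun j hj => not_lt.1 (h hj)
    exact hi.ne' ((Finset.sum_eq_zero_iff_of_nonneg h0).1 hsum i (Finset.mem_univ i))
  -- The ratio test of Carathéodory's theorem: along `c + t μ`, the weight at this `j` is the first
  -- to reach zero.
  obtain ⟨j, hj, hmin⟩ := Finset.exists_min_image _ (fun j => c j / (-μ j)) hne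
  simp only [Finset.mem_filter, Finset.mem_univ, true_and] at hj hmin
  have ht : 0 ≤ c j / (-μ j) := div_nonneg (c0 j) (by linarith)
  have hjX : j ∈ X := by
    by_contra h
    rw [hμX j h] at hj
    exact lt_irrefl _ hj
  refine ⟨j, hjX, hj, ?_⟩
  refine (mem_convexHull_image_iff a _ x).2 ⟨fun l => c l + c j / (-μ j) * μ l, fun l => ?_,
    fun l hl => ?_, ?_⟩
  · rcases lt_or_ge (μ l) 0 with hl | hl
    · have := hmin l hl
      rw [le_div_iff₀ (by linarith)] at this
      dsimp only
      linarith
    · exact add_nonneg (c0 l) (mul_nonneg ht hl)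
  · by_cases hlj : l = j
    · rw [hlj]
      field_simp [hj.ne]
      ring
    · have hlX : l ∉ X := fun h => hl (Finset.mem_erase.2 ⟨hlj, h⟩)
      simp [cX l hlX, hμX l hlX]
  · simp only [add_smul, Finset.sum_add_distrib, mul_smul, ← Finset.smul_sum, hμ, cx, smul_zero,
      add_zero]

/-- The functional of the `d` points other than `i` and `j` kills all other terms of the relation.
Thus the coefficients of a circuit are, up to a common factor and signs, its maximal minors. -/
lemma mul_abs_detPos_erase {a : Fin n → Fin d → ℝ} {X : Finset (Fin n)} (hX : X.card = d + 2)
    {μ : Fin n → ℝ} (hμX : ∀ i ∉ X, μ i = 0) (hμ : ∑ i, μ i • projLift (a i) = 0) {i j : Fin n}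
    (hi : i ∈ X) (hj : j ∈ X) :
    detPos a (X.erase i) * |μ j| = detPos a (X.erase j) * |μ i| := by
  classical
  rcases eq_or_ne i j with rfl | hij
  · rfl
  have hji : j ∈ X.erase i := Finset.mem_erase.2 ⟨hij.symm, hj⟩
  set C := (X.erase i).erase j with hC
  have hCc : C.card = d := by
    rw [hC, Finset.card_erase_of_mem hji, Finset.card_erase_of_mem hi, hX]
    rfl
  have hjC : j ∉ C := Finset.notMem_erase _ _
  have hiC : i ∉ C := fun h => Finset.notMem_erase i X (Finset.mem_of_mem_erase h)
  have h1 : X.erase i = insert j C := (Finset.insert_erase hji).symm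
  have h2 : X.erase j = insert i C := by
    rw [hC, Finset.erase_right_comm, Finset.insert_erase (Finset.mem_erase.2 ⟨hij, hi⟩)]
  rw [h1, h2, detPos_insert a hCc hjC, detPos_insert a hCc hiC, ← abs_mul, ← abs_mul]
  have h3 := congrArg (facetFunctional a C) hμ
  rw [map_zero, map_sum, ← Finset.sum_subset (Finset.subset_univ {i, j}) ?_,
    Finset.sum_pair hij] at h3
  · simp only [map_smul, smul_eq_mul] at h3
    rw [show facetFunctional a C (projLift (a j)) * μ j
      = -(facetFunctional a C (projLift (a i)) * μ i) by linarith, abs_neg]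
  · intro l _ hl
    by_cases hlC : l ∈ C
    · simp [facetFunctional_of_mem a hCc hlC]
    · have : l ∉ X := fun h => hlC (by
        simp only [Finset.mem_insert, Finset.mem_singleton, not_or] at hl
        simp [hC, hl.1, hl.2, h])
      simp [hμX l this]

/-- For a circuit on `d + 2` points, an off-knot point lies in the same number of simplices
obtained by deleting a positive, resp. a negative, element. -/
lemma sum_sign_circuit {a : Fin n → Fin d → ℝ} {x : Fin d → ℝ} (hx : x ∉ knotSet a)
    {X : Finset (Fin n)} (hX : X.card = d + 2) {μ : Fin n → ℝ} (hμX : ∀ i ∉ X, μ i = 0)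
    (hμ : ∑ i, μ i • projLift (a i) = 0) (hbasis : ∀ i ∈ X, μ i ≠ 0 → IsAffBasis a (X.erase i))
    (S : Finset (Fin n))
    (hS : ∀ i, i ∈ S ↔ i ∈ X ∧ μ i ≠ 0 ∧ x ∈ convexHull ℝ (a '' (X.erase i : Set (Fin n)))) :
    ∑ i ∈ S, Real.sign (μ i) = 0 := by
  classical
  refine sum_eq_zero_of_signs S _ (fun i hi h => ((hS i).1 hi).2.1 (Real.sign_eq_zero_iff.1 h))
    (fun i hi j hj hij => ?_) fun i hi => ?_
  · by_contra hne
    obtain ⟨hiX, hμi, hxi⟩ := (hS i).1 hi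
    obtain ⟨hjX, hμj, hxj⟩ := (hS j).1 hj
    obtain ⟨c, c0, cX, cx⟩ := (mem_convexHull_image_iff a _ x).1 hxi
    obtain ⟨c', c0', cX', cx'⟩ := (mem_convexHull_image_iff a _ x).1 hxj
    have hpos : 0 < c j := pos_of_notMem_knotSet hx
      (by rw [Finset.card_erase_of_mem hiX, hX]; rfl) c0 cX cx (by simp [Ne.symm hne, hjX])
    have hpos' : 0 < c' i := pos_of_notMem_knotSet hx
      (by rw [Finset.card_erase_of_mem hjX, hX]; rfl) c0' cX' cx' (by simp [hne, hiX])
    -- The difference `c' - c` of the two representations of `x` is a relation, hence equals `(c' i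
    -- / μ i) μ`. At `j` this reads `-c j = c' i * μ j / μ i`, and positivity of `c j` and `c' i`
    -- excludes equal signs.
    have hz := (hbasis i hiX hμi).eq_zero (c := fun l => c' l - c l - c' i / μ i * μ l)
      (fun l hl => by
        by_cases hli : l = i
        · subst hli
          simp [cX l hl, hμi]
        · have hlX : l ∉ X := fun h => hl (Finset.mem_erase.2 ⟨hli, h⟩)
          simp [cX l hl, cX' l (fun h => hlX (Finset.mem_of_mem_erase h)), hμX l hlX])
      (by simp only [sub_smul, Finset.sum_sub_distrib, mul_smul, ← Finset.smul_sum, hμ, cx, cx',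
            smul_zero, sub_self])
    have hzj := congrFun hz j
    have hcj : c' j = 0 := cX' j (Finset.notMem_erase _ _)
    simp only [hcj, Pi.zero_apply] at hzj
    have h5 : c j * μ i + c' i * μ j = 0 := by
      field_simp at hzj
      linarith
    rcases lt_or_gt_of_ne hμi with h | h <;> rcases lt_or_gt_of_ne hμj with h' | h'
    · nlinarith
    · rw [Real.sign_of_neg h, Real.sign_of_pos h'] at hij; norm_num at hij
    · rw [Real.sign_of_pos h, Real.sign_of_neg h'] at hij; norm_num at hij
    · nlinarith
  · obtain ⟨hiX, hμi, hxi⟩ := (hS i).1 hi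
    have hxX : x ∈ convexHull ℝ (a '' (X : Set (Fin n))) :=
      convexHull_mono (Set.image_mono (by simp)) hxi
    rcases lt_or_gt_of_ne hμi with h | h
    · obtain ⟨j, hjX, hμj, hxj⟩ := exists_mem_convexHull_erase hxX (μ := -μ)
        (fun i hi => by simp [hμX i hi]) (by simp [hμ]) (i := i) (by simpa using h)
      simp only [Pi.neg_apply, neg_neg_iff_pos] at hμj
      exact ⟨j, (hS j).2 ⟨hjX, hμj.ne', hxj⟩, by
        rw [Real.sign_of_pos hμj, Real.sign_of_neg h, neg_neg]⟩
    · obtain ⟨j, hjX, hμj, hxj⟩ := exists_mem_convexHull_erase hxX hμX hμ h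
      exact ⟨j, (hS j).2 ⟨hjX, hμj.ne, hxj⟩, by
        rw [Real.sign_of_neg hμj, Real.sign_of_pos h]⟩

/-- The determinants of the simplices are `κ |μ i|`, so each term is a fixed constant times the sign
of `μ i` times an indicator, and the signs cancel by `sum_sign_circuit`. -/
lemma sum_mul_simplexSpline_zero {a : Fin n → Fin d → ℝ} (β : Finset (Fin n) → Finset (Fin n))
    {x : Fin d → ℝ} (hx : x ∉ knotSet a)
    {X : Finset (Fin n)} (hX : X.card = d + 2) {μ : Fin n → ℝ} (hμX : ∀ i ∉ X, μ i = 0)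
    (hμ : ∑ i, μ i • projLift (a i) = 0) :
    ∑ i, μ i * simplexSpline a β 0 (X.erase i) x = 0 := by
  classical
  by_cases hsp : ∃ B ⊆ X, IsAffBasis a B
  swap
  · exact Finset.sum_eq_zero fun i _ => by
      rw [simplexSpline_eq_zero, mul_zero]
      exact fun ⟨B, hB, h⟩ => hsp ⟨B, hB.trans (Finset.erase_subset _ _), h⟩
  obtain ⟨B, hBX, hB⟩ := hsp
  obtain ⟨j₀, hj₀, rfl⟩ : ∃ j ∈ X, X.erase j = B := by
    obtain ⟨j, hjX, hjB⟩ := Finset.exists_mem_notMem_of_card_lt_card (s := B) (t := X)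
      (by rw [hB.1, hX]; omega)
    refine ⟨j, hjX, (Finset.eq_of_subset_of_card_le (fun i hi => ?_) ?_).symm⟩
    · exact Finset.mem_erase.2 ⟨fun h => hjB (h ▸ hi), hBX hi⟩
    · rw [Finset.card_erase_of_mem hjX, hX, hB.1]; rfl
  by_cases hμ0 : μ = 0
  · simp [hμ0]
  have hμj : μ j₀ ≠ 0 := fun h => hμ0 (hB.eq_zero (fun i hi => by
    by_cases hij : i = j₀
    · rw [hij, h]
    · exact hμX i fun h' => hi (Finset.mem_erase.2 ⟨hij, h'⟩)) hμ)
  set κ := detPos a (X.erase j₀) / |μ j₀| with hκ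
  have hκ0 : 0 < κ := div_pos (detPos_pos hB) (abs_pos.2 hμj)
  have hdet : ∀ i ∈ X, detPos a (X.erase i) = κ * |μ i| := fun i hi => by
    rw [hκ, div_mul_eq_mul_div, eq_div_iff (abs_pos.2 hμj).ne']
    exact mul_abs_detPos_erase hX hμX hμ hi hj₀
  have hbasis : ∀ i ∈ X, μ i ≠ 0 → IsAffBasis a (X.erase i) := fun i hi h => by
    rw [← rowDet_ne_zero_iff, ← abs_pos, ← detPos, hdet i hi]
    exact mul_pos hκ0 (abs_pos.2 h)
  set S := X.filter fun i => μ i ≠ 0 ∧ x ∈ convexHull ℝ (a '' (X.erase i : Set (Fin n))) with hS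
  have hsum := sum_sign_circuit hx hX hμX hμ hbasis S fun i => by rw [hS, Finset.mem_filter]
  calc ∑ i, μ i * simplexSpline a β 0 (X.erase i) x
      = ∑ i ∈ S, d.factorial / κ * Real.sign (μ i) := by
        symm
        rw [← Finset.sum_subset (Finset.subset_univ S)]
        · refine Finset.sum_congr rfl fun i hi => ?_
          obtain ⟨hiX, hμi, hxi⟩ := Finset.mem_filter.1 hi
          rw [simplexSpline, if_pos (hbasis i hiX hμi), Set.indicator_of_mem (by simpa using hxi),
            hdet i hiX]
          rcases lt_or_gt_of_ne hμi with h | h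
          · rw [Real.sign_of_neg h, abs_of_neg h]; field_simp
          · rw [Real.sign_of_pos h, abs_of_pos h]; field_simp
        · intro i _ hi
          by_cases hμi : μ i = 0
          · rw [hμi, zero_mul]
          have hiX : i ∈ X := not_not.1 fun h => hμi (hμX i h)
          rw [simplexSpline, if_pos (hbasis i hiX hμi), Set.indicator_of_notMem]
          · simp
          · exact fun h => hi (Finset.mem_filter.2 ⟨hiX, hμi, by simpa using h⟩)
    _ = 0 := by rw [← Finset.mul_sum, hsum, mul_zero]

/-- Two representations of `x` differ by an affine relation, which `hnull` annihilates. Keeping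
`hnull` as a hypothesis makes this available inside the induction that proves it. -/
lemma simplexSpline_succ_of_null {a : Fin n → Fin d → ℝ} {β : Finset (Fin n) → Finset (Fin n)}
    (hβ : IsBasisChoice a β) {x : Fin d → ℝ} {k : ℕ} {X : Finset (Fin n)}
    (hnull : ∀ μ : Fin n → ℝ, (∀ i ∉ X, μ i = 0) → ∑ i, μ i • projLift (a i) = 0 →
      ∑ i, μ i * simplexSpline a β k (X.erase i) x = 0)
    {c : Fin n → ℝ} (hc : ∀ i ∉ X, c i = 0) (hcx : ∑ i, c i • projLift (a i) = projLift x) :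
    simplexSpline a β (k + 1) X x = (((k + 1 : ℕ) : ℝ) + d) / ((k + 1 : ℕ) : ℝ) *
      ∑ i, c i * simplexSpline a β k (X.erase i) x := by
  classical
  by_cases hsp : ∃ B ⊆ X, IsAffBasis a B
  · obtain ⟨hβX, hβB⟩ := hβ X hsp
    obtain ⟨c', hc', hcx'⟩ := hβB.exists_coord (projLift x)
    have h1 := hnull (c - c') (fun i hi => by simp [hc i hi, hc' i fun h => hi (hβX h)])
      (by simp [sub_smul, hcx, hcx'])
    simp only [Pi.sub_apply, sub_mul, Finset.sum_sub_distrib, sub_eq_zero] at h1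
    rw [simplexSpline, if_pos hsp, h1]
    congr 1
    rw [← Finset.sum_subset (Finset.subset_univ (β X)) fun i _ hi => by rw [hc' i hi, zero_mul]]
    exact Finset.sum_congr rfl fun b hb => by rw [hβB.detReplace_div hc' hcx' hb]
  · rw [simplexSpline_eq_zero a β _ hsp, Finset.sum_eq_zero, mul_zero]
    intro i _
    rw [simplexSpline_eq_zero, mul_zero]
    exact fun ⟨B, hB, h⟩ => hsp ⟨B, hB.trans (Finset.erase_subset _ _), h⟩

/-- Off the knots, an affine relation among the points of `X` is a relation among the splines on
the sets `X \ {i}`. -/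
lemma sum_mul_simplexSpline_erase {a : Fin n → Fin d → ℝ} {β : Finset (Fin n) → Finset (Fin n)}
    (hβ : IsBasisChoice a β) {x : Fin d → ℝ} (hx : x ∉ knotSet a) (k : ℕ) :
    ∀ {X : Finset (Fin n)}, X.card = k + d + 2 → ∀ μ : Fin n → ℝ, (∀ i ∉ X, μ i = 0) →
      ∑ i, μ i • projLift (a i) = 0 →
      ∑ i, μ i * simplexSpline a β k (X.erase i) x = 0 := by
  classical
  induction k with
  | zero =>
    intro X hX μ hμX hμ
    exact sum_mul_simplexSpline_zero β hx (by omega) hμX hμ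
  | succ k ih =>
    intro X hX μ hμX hμ
    by_cases hsp : ∃ B ⊆ X, IsAffBasis a B
    swap
    · exact Finset.sum_eq_zero fun i _ => by
        rw [simplexSpline_eq_zero, mul_zero]
        exact fun ⟨B, hB, h⟩ => hsp ⟨B, hB.trans (Finset.erase_subset _ _), h⟩
    obtain ⟨B, hBX, hB⟩ := hsp
    obtain ⟨c, hcB, hcx⟩ := hB.exists_coord (projLift x)
    have hcX : ∀ i ∉ X, c i = 0 := fun i hi => hcB i fun h => hi (hBX h)
    set r : ℝ := (((k + 1 : ℕ) : ℝ) + d) / ((k + 1 : ℕ) : ℝ)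
    have hcard : ∀ i ∈ X, (X.erase i).card = k + d + 2 := fun i hi => by
      rw [Finset.card_erase_of_mem hi, hX]; omega
    -- If `μ i ≠ 0`, then `c - (c i / μ i) μ` still represents `x` and vanishes at `i`, so it can be
    -- used in the recurrence on `X.erase i`. If `μ i = 0`, both sides vanish by induction.
    have key : ∀ i ∈ X, μ i * simplexSpline a β (k + 1) (X.erase i) x =
        r * ∑ j ∈ X, (μ i * c j - c i * μ j) * simplexSpline a β k ((X.erase i).erase j) x := by
      intro i hi
      have hext : ∀ f : Fin n → ℝ, ∑ j ∈ X, (μ i * c j - c i * μ j) * f j =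
          ∑ j, (μ i * c j - c i * μ j) * f j := fun f =>
        Finset.sum_subset (Finset.subset_univ X) fun j _ hj => by simp [hcX j hj, hμX j hj]
      rw [hext]
      by_cases hμi : μ i = 0
      · have := ih (hcard i hi) μ (fun j hj => by
          by_cases hji : j = i
          · rw [hji, hμi]
          · exact hμX j fun h => hj (Finset.mem_erase.2 ⟨hji, h⟩)) hμ
        simp only [hμi, zero_mul, zero_sub, neg_mul, Finset.sum_neg_distrib, mul_assoc,
          ← Finset.mul_sum, this, mul_zero, neg_zero]
      · rw [simplexSpline_succ_of_null hβ (X := X.erase i) (ih (hcard i hi))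
          (c := fun j => c j - c i / μ i * μ j) ?_ ?_, mul_left_comm, Finset.mul_sum]
        · congr 1
          refine Finset.sum_congr rfl fun j _ => ?_
          rw [← mul_assoc]
          congr 1
          field_simp
        · intro j hj
          by_cases hji : j = i
          · rw [hji, div_mul_cancel₀ _ hμi, sub_self]
          · have hjX : j ∉ X := fun h => hj (Finset.mem_erase.2 ⟨hji, h⟩)
            simp [hcX j hjX, hμX j hjX]
        · simp only [sub_smul, Finset.sum_sub_distrib, mul_smul, ← Finset.smul_sum, hμ, hcx,
            smul_zero, sub_zero]
    rw [← Finset.sum_subset (Finset.subset_univ X) fun i _ hi => by rw [hμX i hi, zero_mul],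
      Finset.sum_congr rfl key, ← Finset.mul_sum]
    set T := ∑ i ∈ X, ∑ j ∈ X,
      (μ i * c j - c i * μ j) * simplexSpline a β k ((X.erase i).erase j) x with hT
    -- The coefficient is antisymmetric in `i` and `j`, while the set with both erased is symmetric.
    have : T = -T := by
      conv_lhs => rw [hT, Finset.sum_comm]
      rw [hT, ← Finset.sum_neg_distrib]
      refine Finset.sum_congr rfl fun i _ => ?_
      rw [← Finset.sum_neg_distrib]
      refine Finset.sum_congr rfl fun j _ => ?_
      rw [Finset.erase_right_comm]
      ring
    rw [show T = 0 by linarith, mul_zero]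

/-- Off the knots, the spline recurrence holds with any affine representation of `x`. -/
theorem simplexSpline_succ_eq {a : Fin n → Fin d → ℝ} {β : Finset (Fin n) → Finset (Fin n)}
    (hβ : IsBasisChoice a β) {x : Fin d → ℝ} (hx : x ∉ knotSet a) {k : ℕ} {X : Finset (Fin n)}
    (hX : X.card = k + d + 2) {c : Fin n → ℝ} (hc : ∀ i ∉ X, c i = 0)
    (hcx : ∑ i, c i • projLift (a i) = projLift x) :
    simplexSpline a β (k + 1) X x = (((k + 1 : ℕ) : ℝ) + d) / ((k + 1 : ℕ) : ℝ) *
      ∑ i, c i * simplexSpline a β k (X.erase i) x :=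
  simplexSpline_succ_of_null hβ (sum_mul_simplexSpline_erase hβ hx k hX) hc hcx

end Spline

/-! ### Coordinates in tiles and faces -/

section Tiles
variable {d n : ℕ}

/-- Coefficient vectors of the points of the tile labelled `(I, B)`. -/
def IsTileCoord (I B : Finset (Fin n)) (c : Fin n → ℝ) : Prop :=
  (∀ i ∈ I, c i = 1) ∧ (∀ i ∈ B, 0 ≤ c i ∧ c i ≤ 1) ∧ ∀ i ∉ I, i ∉ B → c i = 0

lemma mem_tileSet_iff (a : Fin n → Fin d → ℝ) {I B : Finset (Fin n)} (h : Disjoint I B)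
    (y : Fin (d + 1) → ℝ) :
    y ∈ tileSet a I B ↔ ∃ c, IsTileCoord I B c ∧ ∑ i, c i • projLift (a i) = y := by
  classical
  have hsplit : ∀ c : Fin n → ℝ, IsTileCoord I B c → ∑ i, c i • projLift (a i) =
      ∑ i ∈ I, projLift (a i) + ∑ i ∈ B, c i • projLift (a i) := by
    intro c hc
    rw [sum_univ_eq_sum_of_zero_off (X := I ∪ B), Finset.sum_union h]
    · congr 1
      exact Finset.sum_congr rfl fun i hi => by rw [hc.1 i hi, one_smul]
    · intro i hi
      simp only [Finset.mem_union, not_or] at hi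
      exact hc.2.2 i hi.1 hi.2
  rw [tileSet, Set.singleton_add, Set.mem_image]
  constructor
  · rintro ⟨z, hz, rfl⟩
    obtain ⟨g, hg, rfl⟩ := (Set.mem_finsetSum _ _ _).1 hz
    have : ∀ b ∈ B, ∃ t : ℝ, (0 ≤ t ∧ t ≤ 1) ∧ t • projLift (a b) = g b := fun b hb => by
      have hgb := hg hb
      rw [segment_eq_image] at hgb
      obtain ⟨t, ht, ht'⟩ := hgb
      exact ⟨t, ht, by simpa using ht'⟩
    choose! t ht htg using this
    have hc : IsTileCoord I B fun i => if i ∈ I then 1 else if i ∈ B then t i else 0 :=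
      ⟨fun i hi => by simp [hi], fun i hi => by
        simpa [hi, Finset.disjoint_right.1 h hi] using ht i hi, fun i hi hi' => by simp [hi, hi']⟩
    refine ⟨_, hc, ?_⟩
    rw [hsplit _ hc]
    congr 1
    exact Finset.sum_congr rfl fun i hi => by
      simp [hi, Finset.disjoint_right.1 h hi, htg i hi]
  · rintro ⟨c, hc, rfl⟩
    refine ⟨_, (Set.mem_finsetSum _ _ _).2 ⟨fun i => c i • projLift (a i), fun {i} hi => ?_, rfl⟩,
      (hsplit c hc).symm⟩
    rw [segment_eq_image]
    exact ⟨c i, hc.2.1 i hi, by simp⟩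

lemma mem_zonotope_iff (a : Fin n → Fin d → ℝ) (y : Fin (d + 1) → ℝ) :
    y ∈ zonotope a ↔ ∃ c : Fin n → ℝ, (∀ i, 0 ≤ c i ∧ c i ≤ 1) ∧
      ∑ i, c i • projLift (a i) = y := by
  have h : zonotope a = tileSet a ∅ Finset.univ := by simp [zonotope, tileSet]
  rw [h, mem_tileSet_iff a (Finset.disjoint_empty_left _)]
  simp [IsTileCoord]

lemma isClosed_tileSet (a : Fin n → Fin d → ℝ) {I B : Finset (Fin n)} (h : Disjoint I B) :
    IsClosed (tileSet a I B) := by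
  classical
  have hK : IsCompact (Set.univ.pi fun i : Fin n =>
      if i ∈ I then ({1} : Set ℝ) else if i ∈ B then Set.Icc 0 1 else {0}) :=
    isCompact_univ_pi fun i => by
      split_ifs
      exacts [isCompact_singleton, isCompact_Icc, isCompact_singleton]
  have hcont : Continuous fun c : Fin n → ℝ => ∑ i, c i • projLift (a i) := by fun_prop
  convert (hK.image hcont).isClosed
  ext y
  rw [mem_tileSet_iff a h, Set.mem_image]
  refine exists_congr fun c => and_congr_left fun _ => ?_
  rw [Set.mem_univ_pi]
  constructor
  · intro hc i
    split_ifs with h1 h2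
    exacts [hc.1 i h1, hc.2.1 i h2, hc.2.2 i h1 h2]
  · intro hc
    refine ⟨fun i hi => ?_, fun i hi => ?_, fun i hi hi' => ?_⟩
    · simpa [hi] using hc i
    · simpa [hi, Finset.disjoint_right.1 h hi] using hc i
    · simpa [hi, hi'] using hc i

lemma IsTileFace.isTileCoord {J C I B : Finset (Fin n)} (hf : IsTileFace J C I B)
    {c : Fin n → ℝ} (hc : IsTileCoord J C c) :
    (∀ i ∈ I, c i = 1) ∧ (∀ i ∉ I, i ∉ B → c i = 0) := by
  refine ⟨fun i hi => hc.1 i (hf.2.1 hi), fun i hi hi' => hc.2.2 i (fun h => ?_)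
    fun h => hi' (hf.1 h)⟩
  rcases Finset.mem_union.1 (hf.2.2.1 h) with h | h
  exacts [hi h, hi' h]

/-- A face with as many generators as the tile is the tile itself. -/
lemma IsTileFace.eq_of_card {J C I B : Finset (Fin n)} (hf : IsTileFace J C I B)
    (hcard : B.card ≤ C.card) : J = I ∧ C = B := by
  have hCB : C = B := Finset.eq_of_subset_of_card_le hf.1 hcard
  refine ⟨Finset.Subset.antisymm (fun i hi => ?_) hf.2.1, hCB⟩
  rcases Finset.mem_union.1 (hf.2.2.1 hi) with h | h
  · exact h
  · exact absurd (hCB ▸ h) (Finset.disjoint_left.1 hf.2.2.2 hi)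

variable {a : Fin n → Fin d → ℝ} {P : Finset (Finset (Fin n) × Finset (Fin n))}

/-- The coordinates of a point of a tile that lies in a face are face coordinates. -/
lemma IsTileFace.coord_eq {J C I B : Finset (Fin n)} (hf : IsTileFace J C I B)
    (hB : IsAffBasis a B) {c : Fin n → ℝ} (hc : IsTileCoord I B c)
    (hy : ∑ i, c i • projLift (a i) ∈ tileSet a J C) : IsTileCoord J C c := by
  obtain ⟨c', hc', h⟩ := (mem_tileSet_iff a hf.2.2.2 _).1 hy
  have := hf.isTileCoord hc'
  rw [hB.coord_unique (c := c) (c' := c') (fun i hi => ?_) h.symm]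
  · exact hc'
  · by_cases hI : i ∈ I
    · rw [hc.1 i hI, this.1 i hI]
    · rw [hc.2.2 i hI hi, this.2 i hI hi]

/-- Distinct tiles of a fine zonotopal tiling have disjoint interiors. -/
lemma IsFineZonotopalTiling.eq_of_mem_interior (hP : IsFineZonotopalTiling a P)
    {s t : Finset (Fin n) × Finset (Fin n)} (hs : s ∈ P) (ht : t ∈ P) {c : Fin n → ℝ}
    (hc : IsTileCoord t.1 t.2 c) (hint : ∀ b ∈ t.2, 0 < c b ∧ c b < 1)
    (hy : ∑ i, c i • projLift (a i) ∈ tileSet a s.1 s.2) : s = t := by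
  obtain ⟨hsd, hsB⟩ := hP.tile s hs
  obtain ⟨htd, htB⟩ := hP.tile t ht
  have hyt : ∑ i, c i • projLift (a i) ∈ tileSet a t.1 t.2 := (mem_tileSet_iff a htd _).2 ⟨c, hc, rfl⟩
  obtain ⟨J, C, hfs, hft, hJC⟩ := hP.inter s hs t ht ⟨_, hy, hyt⟩
  have hcJC := hft.coord_eq htB hc (hJC ▸ ⟨hy, hyt⟩)
  -- A coordinate strictly between 0 and 1 cannot be frozen on a face. So the common face is all of
  -- `t`, and by counting generators also all of `s`.
  have hsub : t.2 ⊆ C := fun b hb => by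
    by_contra hbC
    by_cases hbJ : b ∈ J
    · exact (hint b hb).2.ne (hcJC.1 b hbJ)
    · exact (hint b hb).1.ne' (hcJC.2.2 b hbJ hbC)
  have hcard := Finset.card_le_card hsub
  have h1 := hft.eq_of_card hcard
  have h2 := hfs.eq_of_card (by rwa [hsB.1, ← htB.1])
  exact Prod.ext (h2.1.symm.trans h1.1) (h2.2.symm.trans h1.2)

end Tiles

/-! ### The tiles on the two sides of a facet -/

section Facets
variable {d n : ℕ} {a : Fin n → Fin d → ℝ} {P : Finset (Finset (Fin n) × Finset (Fin n))}

/-- Coordinates of the centre of the face labelled `(J, C)`. -/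
noncomputable def faceCenter (J C : Finset (Fin n)) (i : Fin n) : ℝ :=
  if i ∈ C then 1 / 2 else if i ∈ J then 1 else 0

/-- The sign with which `v_b` points from the face with index set `J` into the tile obtained from
it by adding the generator `b`. -/
def inwardSign (J : Finset (Fin n)) (b : Fin n) : ℝ := if b ∈ J then -1 else 1

lemma inwardSign_mul_self (J : Finset (Fin n)) (b : Fin n) :
    inwardSign J b * inwardSign J b = 1 := by
  rw [inwardSign]; split_ifs <;> norm_num

lemma faceCenter_mem (J C : Finset (Fin n)) (i : Fin n) :
    0 ≤ faceCenter J C i ∧ faceCenter J C i ≤ 1 := by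
  rw [faceCenter]; split_ifs <;> norm_num

lemma faceCenter_add_inwardSign_mem (J : Finset (Fin n)) {C : Finset (Fin n)} {b : Fin n}
    (hb : b ∉ C) {ε : ℝ} (h0 : 0 ≤ ε) (h1 : ε ≤ 1) :
    0 ≤ faceCenter J C b + ε * inwardSign J b ∧ faceCenter J C b + ε * inwardSign J b ≤ 1 := by
  rw [faceCenter, if_neg hb, inwardSign]
  split_ifs <;> constructor <;> linarith

lemma sum_add_single_smul (c : Fin n → ℝ) (b : Fin n) (r : ℝ) :
    ∑ i, (c + Pi.single b r : Fin n → ℝ) i • projLift (a i) =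
      ∑ i, c i • projLift (a i) + r • projLift (a b) := by
  simp [add_smul, Finset.sum_add_distrib, Pi.single_apply, ite_smul]

/-- The tile label covers upper and lower facets at once: for `b ∈ J` the coefficient of `v_b` on
the facet is 1, and for `b ∉ J` it is 0 and the erasure does nothing. -/
lemma isTileCoord_faceCenter {J C : Finset (Fin n)} (hJC : Disjoint J C) {b : Fin n} :
    IsTileCoord (J.erase b) (insert b C) (faceCenter J C) := by
  refine ⟨fun i hi => ?_, fun i _ => faceCenter_mem J C i, fun i hi hi' => ?_⟩
  · have hiJ := Finset.mem_of_mem_erase hi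
    rw [faceCenter, if_neg (Finset.disjoint_left.1 hJC hiJ), if_pos hiJ]
  · simp only [Finset.mem_insert, not_or] at hi'
    rw [faceCenter, if_neg hi'.2, if_neg fun h => hi (Finset.mem_erase.2 ⟨hi'.1, h⟩)]

lemma isTileCoord_faceCenter_add {J C : Finset (Fin n)} (hJC : Disjoint J C) {b : Fin n}
    (hb : b ∉ C) {ε : ℝ} (h0 : 0 ≤ ε) (h1 : ε ≤ 1) :
    IsTileCoord (J.erase b) (insert b C)
      (faceCenter J C + Pi.single b (ε * inwardSign J b)) := by
  obtain ⟨g1, g2, g3⟩ := isTileCoord_faceCenter hJC (b := b)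
  have hne : ∀ i, i ≠ b →
      (faceCenter J C + Pi.single b (ε * inwardSign J b) : Fin n → ℝ) i = faceCenter J C i :=
    fun i hi => by simp [hi]
  refine ⟨fun i hi => ?_, fun i hi => ?_, fun i hi hi' => ?_⟩
  · rw [hne i (Finset.ne_of_mem_erase hi), g1 i hi]
  · by_cases hib : i = b
    · subst hib
      simpa using faceCenter_add_inwardSign_mem J hb h0 h1
    · rw [hne i hib]; exact g2 i hi
  · rw [hne i fun h => hi' (h ▸ Finset.mem_insert_self _ _), g3 i hi hi']

/-- The tile containing the facet `(J, C)` and the generator `b` lies on one side of it. -/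
lemma IsTileCoord.facetFunctional_eq {J C : Finset (Fin n)} (hJC : Disjoint J C) (hC : C.card = d)
    {b : Fin n} (hb : b ∉ C) {c : Fin n → ℝ} (hc : IsTileCoord (J.erase b) (insert b C) c)
    {w : Fin (d + 1) → ℝ} (hw : ∑ i, c i • projLift (a i) =
      ∑ i, faceCenter J C i • projLift (a i) + w) :
    ∃ r : ℝ, 0 ≤ r ∧ facetFunctional a C w =
      r * (inwardSign J b * facetFunctional a C (projLift (a b))) := by
  have h1 : w = ∑ i, (c - faceCenter J C) i • projLift (a i) := by
    simp [sub_smul, Finset.sum_sub_distrib, hw]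
  have hF := isTileCoord_faceCenter hJC (b := b)
  refine ⟨(c b - faceCenter J C b) * inwardSign J b, ?_, ?_⟩
  · have := hc.2.1 b (Finset.mem_insert_self _ _)
    rw [faceCenter, if_neg hb, inwardSign]
    split_ifs <;> linarith
  · rw [h1, facetFunctional_sum a hC (b := b), mul_assoc, ← mul_assoc (inwardSign J b),
      inwardSign_mul_self, one_mul]
    · rfl
    · intro i hi
      by_cases hiJ : i ∈ J.erase b
      · simp [hc.1 i hiJ, hF.1 i hiJ]
      · simp [hc.2.2 i hiJ hi, hF.2.2 i hiJ hi]

/-- There is at most one tile on either side of a facet. -/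
lemma IsFineZonotopalTiling.facet_unique (hP : IsFineZonotopalTiling a P) {J C : Finset (Fin n)}
    (hJC : Disjoint J C) (hC : C.card = d) {b b' : Fin n} (hb : b ∉ C) (hb' : b' ∉ C)
    (hbP : (J.erase b, insert b C) ∈ P) (hbP' : (J.erase b', insert b' C) ∈ P)
    (hside : 0 < (inwardSign J b * facetFunctional a C (projLift (a b))) *
      (inwardSign J b' * facetFunctional a C (projLift (a b')))) : b = b' := by
  have hB := (hP.tile _ hbP).2
  -- Push the centre of the facet slightly along the inward direction of the second tile. As this
  -- direction also points into the first tile, the point lies in that tile and in the interior of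
  -- the second, so the tiles coincide.
  obtain ⟨e, he, hew⟩ := hB.exists_coord (inwardSign J b' • projLift (a b'))
  have hU := congrArg (facetFunctional a C) hew
  rw [facetFunctional_sum a hC he, map_smul, smul_eq_mul] at hU
  have heb : 0 < e b * inwardSign J b := by
    rw [← hU] at hside
    by_contra hneg
    nlinarith [sq_nonneg (facetFunctional a C (projLift (a b)))]
  set M := ∑ i, |e i| with hM
  have hM0 : 0 ≤ M := Finset.sum_nonneg fun i _ => abs_nonneg _
  -- Small enough that no coordinate moves by more than 1/2, the distance from the coordinates 1/2
  -- of the centre to 0 and 1.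
  set δ : ℝ := 1 / (2 * (1 + M)) with hδ
  have hδ0 : 0 < δ := by positivity
  have hδ1 : δ < 1 := by rw [hδ, div_lt_one (by positivity)]; linarith
  have hsmall : ∀ i, |δ * e i| ≤ 1 / 2 := fun i => by
    have : |e i| ≤ M := Finset.single_le_sum (f := fun i => |e i|) (fun i _ => abs_nonneg _)
      (Finset.mem_univ i)
    rw [abs_mul, abs_of_pos hδ0, hδ, div_mul_eq_mul_div, div_le_div_iff₀ (by positivity) two_pos]
    linarith
  have hF := isTileCoord_faceCenter hJC (b := b)
  have hcoord : IsTileCoord (J.erase b) (insert b C) (faceCenter J C + δ • e) := by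
    refine ⟨fun i hi => ?_, fun i hi => ?_, fun i hi hi' => ?_⟩
    · have : i ∉ insert b C := fun h => (Finset.mem_insert.1 h).elim (Finset.ne_of_mem_erase hi)
        (Finset.disjoint_left.1 hJC (Finset.mem_of_mem_erase hi))
      simp [hF.1 i hi, he i this]
    · have hsi := abs_le.1 (hsmall i)
      rcases Finset.mem_insert.1 hi with rfl | hiC
      · simp only [Pi.add_apply, Pi.smul_apply, smul_eq_mul, faceCenter, if_neg hb]
        rw [inwardSign] at heb
        split_ifs at heb ⊢
        · have : δ * e i ≤ 0 := mul_nonpos_of_nonneg_of_nonpos hδ0.le (by linarith)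
          constructor <;> linarith
        · have : 0 ≤ δ * e i := mul_nonneg hδ0.le (by linarith)
          constructor <;> linarith
      · simp only [Pi.add_apply, Pi.smul_apply, smul_eq_mul, faceCenter, if_pos hiC]
        constructor <;> linarith
    · simp [hF.2.2 i hi hi', he i hi']
  have hmem : ∑ i, (faceCenter J C + Pi.single b' (δ * inwardSign J b') : Fin n → ℝ) i •
      projLift (a i) ∈ tileSet a (J.erase b) (insert b C) := by
    refine (mem_tileSet_iff a (hP.tile _ hbP).1 _).2 ⟨_, hcoord, ?_⟩
    rw [sum_add_single_smul, mul_smul, ← hew]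
    simp [add_smul, Finset.sum_add_distrib, mul_smul, Finset.smul_sum]
  have heq := hP.eq_of_mem_interior hbP hbP' (isTileCoord_faceCenter_add hJC hb' hδ0.le hδ1.le)
    (fun i hi => ?_) hmem
  · have h2 : insert b C = insert b' C := congrArg Prod.snd heq
    have : b ∈ insert b' C := h2 ▸ Finset.mem_insert_self b C
    exact (Finset.mem_insert.1 this).resolve_right hb
  · rcases Finset.mem_insert.1 hi with rfl | hiC
    · simp only [Pi.add_apply, Pi.single_eq_same, faceCenter, if_neg hb', inwardSign]
      split_ifs <;> constructor <;> linarith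
    · have hne : i ≠ b' := fun h => hb' (h ▸ hiC)
      simp only [Pi.add_apply, Pi.single_eq_of_ne hne, faceCenter, if_pos hiC]
      norm_num

/-- If the zonotope extends to the other side of a facet of a tile, there is a tile there. -/
lemma IsFineZonotopalTiling.exists_opposite (hP : IsFineZonotopalTiling a P)
    {J C : Finset (Fin n)} (hJC : Disjoint J C) (hC : C.card = d) {b : Fin n} (hb : b ∉ C)
    (hbP : (J.erase b, insert b C) ∈ P) {w : Fin (d + 1) → ℝ}
    (hw : facetFunctional a C w * (inwardSign J b * facetFunctional a C (projLift (a b))) < 0)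
    (hZ : ∀ ε : ℝ, 0 ≤ ε → ε ≤ 1 →
      ∑ i, faceCenter J C i • projLift (a i) + ε • w ∈ zonotope a) :
    ∃ b' ∉ C, (J.erase b', insert b' C) ∈ P ∧
      (inwardSign J b * facetFunctional a C (projLift (a b))) *
        (inwardSign J b' * facetFunctional a C (projLift (a b'))) < 0 := by
  classical
  set y := ∑ i, faceCenter J C i • projLift (a i) with hy
  -- Finitely many tiles cover the segment, so one of them contains points `y + ε w` with `ε > 0`
  -- arbitrarily small. It is closed, so it contains `y` too.
  obtain ⟨t, htP, htf⟩ : ∃ t ∈ P, ∃ᶠ ε in nhdsWithin (0 : ℝ) (Set.Ioi 0),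
      y + ε • w ∈ tileSet a t.1 t.2 := by
    by_contra! h
    have h1 := (Filter.eventually_all_finset P).2 h
    have h2 : ∀ᶠ ε in nhdsWithin (0 : ℝ) (Set.Ioi 0), ε ∈ Set.Ioo (0 : ℝ) 1 :=
      Ioo_mem_nhdsGT one_pos
    obtain ⟨ε, hε1, hε2⟩ := (h1.and h2).exists
    have h3 := hZ ε hε2.1.le hε2.2.le
    rw [← hP.cover] at h3
    obtain ⟨t, ht, h4⟩ := Set.mem_iUnion₂.1 h3
    exact hε1 t ht h4
  obtain ⟨htd, htB⟩ := hP.tile t htP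
  obtain ⟨hsd, hsB⟩ := hP.tile _ hbP
  have htend : Filter.Tendsto (fun ε : ℝ => y + ε • w) (nhdsWithin (0 : ℝ) (Set.Ioi 0))
      (nhds y) := by
    have : Continuous fun ε : ℝ => y + ε • w := by fun_prop
    exact (by simpa using this.tendsto 0 : Filter.Tendsto _ _ (nhds y)).mono_left
      nhdsWithin_le_nhds
  have hyt : y ∈ tileSet a t.1 t.2 :=
    (isClosed_tileSet a htd).mem_of_frequently_of_tendsto htf htend
  obtain ⟨ε, hεt, hε0⟩ := (htf.and_eventually self_mem_nhdsWithin).exists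
  have hε0 : 0 < ε := hε0
  have hF := isTileCoord_faceCenter hJC (b := b)
  have hys : y ∈ tileSet a (J.erase b) (insert b C) := (mem_tileSet_iff a hsd _).2 ⟨_, hF, rfl⟩
  obtain ⟨J', C', hfs, hft, hint⟩ := hP.inter _ hbP t htP ⟨y, hys, hyt⟩
  have hF' := hfs.coord_eq hsB hF (hint ▸ ⟨hys, hyt⟩)
  have hCC' : C ⊆ C' := fun i hi => by
    have hhalf : faceCenter J C i = 1 / 2 := by rw [faceCenter, if_pos hi]
    by_contra hiC
    by_cases hiJ : i ∈ J'
    · have := hF'.1 i hiJ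
      rw [hhalf] at this; norm_num at this
    · have := hF'.2.2 i hiJ hiC
      rw [hhalf] at this; norm_num at this
  obtain ⟨c, hc, hcy⟩ := (mem_tileSet_iff a htd _).1 hεt
  -- In this case the common face is the whole given tile, so `t` is that tile, which lies on the
  -- wrong side of the facet.
  by_cases hbC' : b ∈ C'
  · have hcard : (insert b C).card ≤ C'.card :=
      Finset.card_le_card (Finset.insert_subset hbC' hCC')
    have h1 := hfs.eq_of_card hcard
    have h2 := hft.eq_of_card (by rwa [htB.1, ← hsB.1])
    rw [← h2.1, ← h2.2, h1.1, h1.2] at hc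
    obtain ⟨r, hr, hrU⟩ := hc.facetFunctional_eq hJC hC hb hcy
    exfalso
    rw [map_smul, smul_eq_mul] at hrU
    set u := inwardSign J b * facetFunctional a C (projLift (a b))
    have h3 : ε * (facetFunctional a C w * u) = r * (u * u) := by
      rw [← mul_assoc, hrU]; ring
    linarith [mul_neg_of_pos_of_neg hε0 hw, mul_nonneg hr (mul_self_nonneg u)]
  -- Otherwise the common face is the facet `(J, C)` itself: the centre determines its label. One
  -- generator `b'` of `t` remains.
  · have hC'C : C' = C := by
      refine Finset.Subset.antisymm (fun i hi => ?_) hCC'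
      exact (Finset.mem_insert.1 (hfs.1 hi)).resolve_left fun h => hbC' (h ▸ hi)
    subst hC'C
    have hJ'J : J' = J := by
      ext i
      constructor
      · intro hi
        have := hF'.1 i hi
        by_contra hiJ
        rw [faceCenter, if_neg (Finset.disjoint_left.1 hft.2.2.2 hi), if_neg hiJ] at this
        norm_num at this
      · intro hi
        have hiC := Finset.disjoint_left.1 hJC hi
        by_contra hiJ'
        have := hF'.2.2 i hiJ' hiC
        rw [faceCenter, if_neg hiC, if_pos hi] at this
        norm_num at this
    subst hJ'J
    obtain ⟨b', hb't, hb'C⟩ := Finset.exists_mem_notMem_of_card_lt_card (s := C') (t := t.2)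
      (by rw [htB.1, hC]; omega)
    have ht2 : insert b' C' = t.2 := Finset.eq_of_subset_of_card_le
      (Finset.insert_subset hb't hft.1)
      (by rw [Finset.card_insert_of_notMem hb'C, hC, htB.1])
    have ht1 : J'.erase b' = t.1 := by
      ext i
      constructor
      · intro hi
        obtain ⟨hib, hiJ⟩ := Finset.mem_erase.1 hi
        refine (Finset.mem_union.1 (hft.2.2.1 hiJ)).resolve_right fun h => ?_
        rw [← ht2] at h
        exact Finset.disjoint_left.1 hJC hiJ ((Finset.mem_insert.1 h).resolve_left hib)
      · intro hi
        exact Finset.mem_erase.2 ⟨fun h => Finset.disjoint_left.1 htd hi (h ▸ hb't), hft.2.1 hi⟩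
    refine ⟨b', hb'C, ?_, ?_⟩
    · rw [ht1, ht2]; exact htP
    · rw [← ht1, ← ht2] at hc
      obtain ⟨r, hr, hrU⟩ := hc.facetFunctional_eq hJC hC hb'C hcy
      rw [map_smul, smul_eq_mul] at hrU
      set u := inwardSign J' b * facetFunctional a C' (projLift (a b))
      set u' := inwardSign J' b' * facetFunctional a C' (projLift (a b'))
      by_contra hneg
      push Not at hneg
      have h1 : ε * (facetFunctional a C' w * u) = r * (u * u') := by
        rw [← mul_assoc, hrU]; ring
      nlinarith [mul_nonneg hr hneg, mul_neg_of_pos_of_neg hε0 hw]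

end Facets

/-! ### Unbalanced facets lie in a hyperplane -/

section Cancellation
variable {d n : ℕ} {a : Fin n → Fin d → ℝ} {P : Finset (Finset (Fin n) × Finset (Fin n))}

lemma continuous_projLift : Continuous (projLift (d := d)) := by
  refine continuous_pi fun j => ?_
  refine Fin.lastCases ?_ (fun j => ?_) j
  · simpa using continuous_const
  · simpa using continuous_apply j

lemma projLift_combo {s t : ℝ} (hst : s + t = 1) (p q : Fin d → ℝ) :
    projLift (s • p + t • q) = s • projLift p + t • projLift q := by
  ext j
  refine Fin.lastCases ?_ (fun j => ?_) j
  · simpa using hst.symm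
  · simp

/-- A linear functional that is positive at a point of the configuration is positive at a vertex. -/
lemma exists_extremePoint_pos (L : (Fin (d + 1) → ℝ) →ₗ[ℝ] ℝ) {i : Fin n}
    (hi : 0 < L (projLift (a i))) : ∃ p ∈ (hull a).extremePoints ℝ, 0 < L (projLift p) := by
  by_contra! h
  have hcpt : IsCompact (hull a) := (Set.finite_range a).isCompact_convexHull ℝ
  have hcont : Continuous fun p => L (projLift p) :=
    (LinearMap.continuous_of_finiteDimensional L).comp continuous_projLift
  have hclosed : IsClosed {p | L (projLift p) ≤ 0} := isClosed_le hcont continuous_const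
  have hconv : Convex ℝ {p | L (projLift p) ≤ 0} := by
    intro p hp q hq s t hs ht hst
    simp only [Set.mem_ofPred] at hp hq ⊢
    rw [projLift_combo hst, map_add, map_smul, map_smul, smul_eq_mul, smul_eq_mul]
    nlinarith
  have hsub : hull a ⊆ {p | L (projLift p) ≤ 0} := by
    rw [← closure_convexHull_extremePoints hcpt (convex_convexHull ℝ _)]
    exact closure_minimal (convexHull_min h hconv) hclosed
  exact (hsub (subset_convexHull ℝ _ ⟨i, rfl⟩)).not_gt hi

open Classical in
/-- The generators `b` for which `(J, C)` labels a facet of a tile with the further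
generator `b`. -/
noncomputable def adjacentGenerators (P : Finset (Finset (Fin n) × Finset (Fin n)))
    (J C : Finset (Fin n)) : Finset (Fin n) :=
  Finset.univ.filter fun b => b ∉ C ∧ (J.erase b, insert b C) ∈ P

lemma mem_adjacentGenerators {J C : Finset (Fin n)} {b : Fin n} :
    b ∈ adjacentGenerators P J C ↔ b ∉ C ∧ (J.erase b, insert b C) ∈ P := by
  classical
  simp [adjacentGenerators]

lemma sign_inwardSign_mul (J : Finset (Fin n)) (b : Fin n) (r : ℝ) :
    Real.sign (inwardSign J b * r) = inwardSign J b * Real.sign r := by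
  rw [inwardSign]
  split_ifs <;> simp [Real.sign_neg]

/-- Either the functional of `C` vanishes on `J`, and then `J ∪ C` lies in a hyperplane, or the
zonotope extends to both sides of the facet. In the latter case any adjacent tile has exactly one
partner opposite, and the signs cancel. -/
lemma IsFineZonotopalTiling.not_exists_basis_of_sum_ne_zero (hP : IsFineZonotopalTiling a P)
    {k : ℕ} (hrep : ∀ p ∈ (hull a).extremePoints ℝ,
      k + 1 ≤ (Finset.univ.filter (fun i : Fin n => a i = p)).card)
    {J C : Finset (Fin n)} (hJC : Disjoint J C) (hJ : J.card = k) (hC : C.card = d)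
    (hne : ∑ b ∈ adjacentGenerators P J C,
      inwardSign J b * Real.sign (facetFunctional a C (projLift (a b))) ≠ 0) :
    ¬ ∃ B ⊆ J ∪ C, IsAffBasis a B := by
  classical
  set U := facetFunctional a C with hU
  have hUne : ∀ b ∈ adjacentGenerators P J C, inwardSign J b * U (projLift (a b)) ≠ 0 := by
    intro b hb
    obtain ⟨hbC, hbP⟩ := mem_adjacentGenerators.1 hb
    refine mul_ne_zero ?_ ((facetFunctional_ne_zero_iff a hC hbC).2 (hP.tile _ hbP).2)
    rw [inwardSign]; split_ifs <;> norm_num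
  by_cases hflat : ∀ i ∈ J, U (projLift (a i)) = 0
  · rintro ⟨B, hBX, hB⟩
    obtain ⟨b, hb, -⟩ := Finset.exists_ne_zero_of_sum_ne_zero hne
    obtain ⟨c, hcB, hcb⟩ := hB.exists_coord (projLift (a b))
    apply right_ne_zero_of_mul (hUne b hb)
    rw [← hcb, map_sum]
    refine Finset.sum_eq_zero fun i _ => ?_
    by_cases hi : i ∈ B
    · rcases Finset.mem_union.1 (hBX hi) with h | h
      · rw [map_smul, hflat i h, smul_zero]
      · rw [map_smul, hU, facetFunctional_of_mem a hC h, smul_zero]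
    · simp [hcB i hi]
  · exfalso
    push Not at hflat
    obtain ⟨i₀, hi₀, hUi₀⟩ := hflat
    -- If no move within the zonotope led to the side `τ`, the indices with `τ • U` positive would
    -- all lie in `J`. There is one, `i₀`, hence a vertex of the hull with the same property. Its `k
    -- + 1` copies do not fit into `J`.
    have hdir : ∀ τ : ℝ, τ ≠ 0 → ∃ i ∉ C, 0 < τ * (inwardSign J i * U (projLift (a i))) := by
      intro τ hτ
      by_contra! h
      have h' : ∀ i, τ * (inwardSign J i * U (projLift (a i))) ≤ 0 := fun i => by
        by_cases hi : i ∈ C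
        · rw [hU, facetFunctional_of_mem a hC hi, mul_zero, mul_zero]
        · exact h i hi
      have h0 : 0 < (τ • U) (projLift (a i₀)) := by
        have h1 := h' i₀
        rw [inwardSign, if_pos hi₀] at h1
        refine lt_of_le_of_ne ?_ (mul_ne_zero hτ hUi₀).symm
        simp only [LinearMap.smul_apply, smul_eq_mul]
        linarith
      obtain ⟨p, hp, hpos⟩ := exists_extremePoint_pos _ h0
      have hle := hrep p hp
      have hsub : (Finset.univ.filter fun i : Fin n => a i = p) ⊆ J := fun i hi => by
        obtain ⟨-, rfl⟩ := Finset.mem_filter.1 hi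
        by_contra hiJ
        have h1 := h' i
        rw [inwardSign, if_neg hiJ, one_mul] at h1
        exact hpos.not_ge h1
      have := Finset.card_le_card hsub
      omega
    have hmem : ∀ i ∉ C, ∀ ε : ℝ, 0 ≤ ε → ε ≤ 1 → ∑ j, faceCenter J C j • projLift (a j) +
        ε • (inwardSign J i • projLift (a i)) ∈ zonotope a := by
      intro i hi ε h0 h1
      refine (mem_zonotope_iff a _).2 ⟨faceCenter J C + Pi.single i (ε * inwardSign J i), ?_, ?_⟩
      · intro j
        by_cases hj : j = i
        · subst hj
          simpa using faceCenter_add_inwardSign_mem J hi h0 h1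
        · simpa [hj] using faceCenter_mem J C j
      · rw [sum_add_single_smul, mul_smul]
    apply hne
    have hsign : ∀ r s : ℝ, r ≠ 0 → s ≠ 0 → Real.sign r = Real.sign s → 0 < r * s := by
      intro r s hr hs h
      rcases lt_or_gt_of_ne hr with h1 | h1 <;> rcases lt_or_gt_of_ne hs with h2 | h2
      · exact mul_pos_of_neg_of_neg h1 h2
      · rw [Real.sign_of_neg h1, Real.sign_of_pos h2] at h; norm_num at h
      · rw [Real.sign_of_pos h1, Real.sign_of_neg h2] at h; norm_num at h
      · exact mul_pos h1 h2
    simp only [← sign_inwardSign_mul]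
    refine sum_eq_zero_of_signs _ _ (fun b hb h => hUne b hb (Real.sign_eq_zero_iff.1 h))
      (fun b hb b' hb' h => ?_) (fun b hb => ?_)
    · obtain ⟨hbC, hbP⟩ := mem_adjacentGenerators.1 hb
      obtain ⟨hbC', hbP'⟩ := mem_adjacentGenerators.1 hb'
      exact hP.facet_unique hJC hC hbC hbC' hbP hbP' (hsign _ _ (hUne b hb) (hUne b' hb') h)
    · obtain ⟨hbC, hbP⟩ := mem_adjacentGenerators.1 hb
      obtain ⟨i, hiC, hi⟩ := hdir _ (neg_ne_zero.2 (hUne b hb))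
      obtain ⟨b', hbC', hbP', hopp⟩ := hP.exists_opposite hJC hC hbC hbP
        (w := inwardSign J i • projLift (a i))
        (by rw [map_smul, smul_eq_mul]; linarith) (hmem i hiC)
      have hb' := mem_adjacentGenerators.2 ⟨hbC', hbP'⟩
      refine ⟨b', hb', ?_⟩
      rw [← Real.sign_neg]
      rcases lt_or_gt_of_ne (hUne b hb) with h1 | h1
      · rw [Real.sign_of_pos ((neg_iff_pos_of_mul_neg hopp).1 h1), Real.sign_of_pos (by linarith)]
      · rw [Real.sign_of_neg ((pos_iff_neg_of_mul_neg hopp).1 h1), Real.sign_of_neg (by linarith)]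

end Cancellation

/-! ### Regrouping sums over tiles by facets -/

section Reindex
variable {d n : ℕ} {a : Fin n → Fin d → ℝ} {P : Finset (Finset (Fin n) × Finset (Fin n))}

open Classical in
/-- The possible labels `(J, C)` of facets with `|J| = m`. -/
noncomputable def facetLabels (d n m : ℕ) : Finset (Finset (Fin n) × Finset (Fin n)) :=
  Finset.univ.filter fun f => f.1.card = m ∧ f.2.card = d ∧ Disjoint f.1 f.2

lemma mem_facetLabels {m : ℕ} {f : Finset (Fin n) × Finset (Fin n)} :
    f ∈ facetLabels d n m ↔ f.1.card = m ∧ f.2.card = d ∧ Disjoint f.1 f.2 := by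
  classical
  simp [facetLabels]

/-- A tile with a chosen generator `b` amounts to a facet with an adjacent generator; `b ∉ J`
records that the coefficient of `v_b` is 0 on the facet. -/
lemma IsFineZonotopalTiling.sum_lower (hP : IsFineZonotopalTiling a P) (m : ℕ)
    (F : Finset (Fin n) → Finset (Fin n) → Fin n → ℝ) :
    ∑ t ∈ P.filter (fun t => t.1.card = m), ∑ b ∈ t.2, F t.1 (t.2.erase b) b =
      ∑ f ∈ facetLabels d n m,
        ∑ b ∈ (adjacentGenerators P f.1 f.2).filter (· ∉ f.1), F f.1 f.2 b := by
  rw [Finset.sum_sigma', Finset.sum_sigma']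
  refine Finset.sum_bij' (fun s _ => ⟨(s.1.1, s.1.2.erase s.2), s.2⟩)
    (fun s _ => ⟨(s.1.1, insert s.2 s.1.2), s.2⟩) ?_ ?_ ?_ ?_ ?_
  · rintro ⟨⟨I, B⟩, b⟩ h
    simp only [Finset.mem_sigma, Finset.mem_filter] at h
    obtain ⟨hd, hB⟩ := hP.tile _ h.1.1
    have hbI : b ∉ I := Finset.disjoint_right.1 hd h.2
    simp only [Finset.mem_sigma, Finset.mem_filter, mem_facetLabels, mem_adjacentGenerators,
      Finset.insert_erase h.2, Finset.erase_eq_of_notMem hbI]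
    exact ⟨⟨h.1.2, by rw [Finset.card_erase_of_mem h.2, hB.1]; rfl,
      hd.mono_right (Finset.erase_subset _ _)⟩, ⟨Finset.notMem_erase _ _, h.1.1⟩, hbI⟩
  · rintro ⟨⟨J, C⟩, b⟩ h
    simp only [Finset.mem_sigma, Finset.mem_filter, mem_facetLabels, mem_adjacentGenerators] at h
    have hJ := h.2.1.2
    rw [Finset.erase_eq_of_notMem h.2.2] at hJ
    simp only [Finset.mem_sigma, Finset.mem_filter]
    exact ⟨⟨hJ, h.1.1⟩, Finset.mem_insert_self _ _⟩
  · rintro ⟨⟨I, B⟩, b⟩ h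
    simp only [Finset.mem_sigma, Finset.mem_filter] at h
    simp [Finset.insert_erase h.2]
  · rintro ⟨⟨J, C⟩, b⟩ h
    simp only [Finset.mem_sigma, Finset.mem_filter, mem_adjacentGenerators] at h
    simp [Finset.erase_insert h.2.1.1]
  · rintro ⟨⟨I, B⟩, b⟩ _
    rfl

/-- Here `b` has coefficient 1 on the facet and so belongs to `J`, which raises the size of the
first label by one. -/
lemma IsFineZonotopalTiling.sum_upper (hP : IsFineZonotopalTiling a P) (m : ℕ)
    (F : Finset (Fin n) → Finset (Fin n) → Fin n → ℝ) :
    ∑ t ∈ P.filter (fun t => t.1.card = m), ∑ b ∈ t.2, F (insert b t.1) (t.2.erase b) b =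
      ∑ f ∈ facetLabels d n (m + 1),
        ∑ b ∈ (adjacentGenerators P f.1 f.2).filter (· ∈ f.1), F f.1 f.2 b := by
  rw [Finset.sum_sigma', Finset.sum_sigma']
  refine Finset.sum_bij' (fun s _ => ⟨(insert s.2 s.1.1, s.1.2.erase s.2), s.2⟩)
    (fun s _ => ⟨(s.1.1.erase s.2, insert s.2 s.1.2), s.2⟩) ?_ ?_ ?_ ?_ ?_
  · rintro ⟨⟨I, B⟩, b⟩ h
    simp only [Finset.mem_sigma, Finset.mem_filter] at h
    obtain ⟨hd, hB⟩ := hP.tile _ h.1.1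
    have hbI : b ∉ I := Finset.disjoint_right.1 hd h.2
    simp only [Finset.mem_sigma, Finset.mem_filter, mem_facetLabels, mem_adjacentGenerators,
      Finset.insert_erase h.2, Finset.erase_insert hbI]
    refine ⟨⟨by rw [Finset.card_insert_of_notMem hbI, h.1.2],
      by rw [Finset.card_erase_of_mem h.2, hB.1]; rfl, ?_⟩,
      ⟨Finset.notMem_erase _ _, h.1.1⟩, Finset.mem_insert_self _ _⟩
    rw [Finset.disjoint_insert_left]
    exact ⟨Finset.notMem_erase _ _, hd.mono_right (Finset.erase_subset _ _)⟩
  · rintro ⟨⟨J, C⟩, b⟩ h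
    simp only [Finset.mem_sigma, Finset.mem_filter, mem_facetLabels, mem_adjacentGenerators] at h
    simp only [Finset.mem_sigma, Finset.mem_filter]
    exact ⟨⟨h.2.1.2, by rw [Finset.card_erase_of_mem h.2.2, h.1.1]; rfl⟩,
      Finset.mem_insert_self _ _⟩
  · rintro ⟨⟨I, B⟩, b⟩ h
    simp only [Finset.mem_sigma, Finset.mem_filter] at h
    have hbI : b ∉ I := Finset.disjoint_right.1 (hP.tile _ h.1.1).1 h.2
    simp [Finset.insert_erase h.2, Finset.erase_insert hbI]
  · rintro ⟨⟨J, C⟩, b⟩ h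
    simp only [Finset.mem_sigma, Finset.mem_filter, mem_adjacentGenerators] at h
    simp [Finset.erase_insert h.2.1.1, Finset.insert_erase h.2.2]
  · rintro ⟨⟨I, B⟩, b⟩ _
    rfl

/-- Exchange of the sums over lower facets of tiles with `|I| = k + 1` and over upper facets of
tiles with `|I| = k`. -/
lemma IsFineZonotopalTiling.sum_lower_eq_sum_upper (hP : IsFineZonotopalTiling a P) {k : ℕ}
    (hrep : ∀ p ∈ (hull a).extremePoints ℝ,
      k + 2 ≤ (Finset.univ.filter (fun i : Fin n => a i = p)).card)
    (G : Finset (Fin n) → Finset (Fin n) → ℝ)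
    (hG : ∀ J C : Finset (Fin n), (¬ ∃ B ⊆ J ∪ C, IsAffBasis a B) → G J C = 0) :
    ∑ t ∈ P.filter (fun t => t.1.card = k + 1), ∑ b ∈ t.2, G t.1 (t.2.erase b) *
        Real.sign (facetFunctional a (t.2.erase b) (projLift (a b))) =
      ∑ t ∈ P.filter (fun t => t.1.card = k), ∑ b ∈ t.2, G (insert b t.1) (t.2.erase b) *
        Real.sign (facetFunctional a (t.2.erase b) (projLift (a b))) := by
  rw [hP.sum_lower (k + 1) fun J C b => G J C * Real.sign (facetFunctional a C (projLift (a b))),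
    hP.sum_upper k fun J C b => G J C * Real.sign (facetFunctional a C (projLift (a b))),
    ← sub_eq_zero, ← Finset.sum_sub_distrib]
  refine Finset.sum_eq_zero fun f hf => ?_
  obtain ⟨hJ, hC, hJC⟩ := mem_facetLabels.1 hf
  -- Lower minus upper contributions is the sum weighted by `inwardSign`, since an upper facet is
  -- approached against `v_b`.
  have hsum : ∑ b ∈ (adjacentGenerators P f.1 f.2).filter (· ∉ f.1),
        G f.1 f.2 * Real.sign (facetFunctional a f.2 (projLift (a b))) -
      ∑ b ∈ (adjacentGenerators P f.1 f.2).filter (· ∈ f.1),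
        G f.1 f.2 * Real.sign (facetFunctional a f.2 (projLift (a b))) =
      G f.1 f.2 * ∑ b ∈ adjacentGenerators P f.1 f.2,
        inwardSign f.1 b * Real.sign (facetFunctional a f.2 (projLift (a b))) := by
    rw [Finset.sum_filter, Finset.sum_filter, ← Finset.sum_sub_distrib, Finset.mul_sum]
    refine Finset.sum_congr rfl fun b _ => ?_
    rw [inwardSign]
    split_ifs <;> first | contradiction | ring
  rw [hsum]
  by_cases h : ∑ b ∈ adjacentGenerators P f.1 f.2,
        inwardSign f.1 b * Real.sign (facetFunctional a f.2 (projLift (a b))) = 0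
  · rw [h, mul_zero]
  · rw [hG _ _ (hP.not_exists_basis_of_sum_ne_zero hrep hJC hJ hC h), zero_mul]

end Reindex

/-! ### Multiaffine functions and polar forms -/

section Multiaffine
variable {d n k : ℕ}

/-- `Q` is affine in each of its `k` arguments. -/
def IsMultiaffine (Q : (Fin k → Fin d → ℝ) → ℝ) : Prop :=
  ∀ (p : Fin k → Fin d → ℝ) (j : Fin k) (y z : Fin d → ℝ) (s : ℝ),
    Q (Function.update p j ((1 - s) • y + s • z)) =
      (1 - s) * Q (Function.update p j y) + s * Q (Function.update p j z)

/-- `f - f 0` is linear: homogeneity is the hypothesis on lines through 0, and additivity is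
homogeneity by 2 applied at a midpoint. -/
lemma map_sum_smul_of_affine {E ι : Type*} [AddCommGroup E] [Module ℝ E] {f : E → ℝ}
    (hf : ∀ (y z : E) (s : ℝ), f ((1 - s) • y + s • z) = (1 - s) * f y + s * f z)
    (S : Finset ι) (c : ι → ℝ) (p : ι → E) (hc : ∑ i ∈ S, c i = 1) :
    f (∑ i ∈ S, c i • p i) = ∑ i ∈ S, c i * f (p i) := by
  have hsmul : ∀ (s : ℝ) (z : E), f (s • z) - f 0 = s * (f z - f 0) := fun s z => by
    have := hf 0 z s
    rw [smul_zero, zero_add] at this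
    rw [this]; ring
  have hadd : ∀ y z : E, f (y + z) - f 0 = (f y - f 0) + (f z - f 0) := fun y z => by
    have h1 := hsmul 2 ((1 - (1 / 2 : ℝ)) • y + (1 / 2 : ℝ) • z)
    rw [hf, smul_add, smul_smul, smul_smul] at h1
    norm_num at h1
    rw [h1]; ring
  let g : E →ₗ[ℝ] ℝ := { toFun := fun y => f y - f 0, map_add' := hadd, map_smul' := hsmul }
  have hg : f (∑ i ∈ S, c i • p i) - f 0 = ∑ i ∈ S, c i * (f (p i) - f 0) := by
    have := map_sum g (fun i => c i • p i) S
    simp only [map_smul] at this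
    exact this
  simp only [mul_sub, Finset.sum_sub_distrib, ← Finset.sum_mul, hc, one_mul] at hg
  linarith

lemma IsMultiaffine.cons_apply {Q : (Fin (k + 1) → Fin d → ℝ) → ℝ} (hQ : IsMultiaffine Q)
    (x : Fin d → ℝ) :
    IsMultiaffine fun p : Fin k → Fin d → ℝ => Q (Fin.cons (α := fun _ => Fin d → ℝ) x p) := by
  intro p j y z s
  simp only [Fin.cons_update]
  exact hQ _ _ _ _ _

lemma symm_cons_apply {Q : (Fin (k + 1) → Fin d → ℝ) → ℝ}
    (hQ : ∀ (σ : Equiv.Perm (Fin (k + 1))) p, Q (p ∘ σ) = Q p) (x : Fin d → ℝ)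
    (σ : Equiv.Perm (Fin k)) (p : Fin k → Fin d → ℝ) :
    Q (Fin.cons (α := fun _ => Fin d → ℝ) x (p ∘ σ)) =
      Q (Fin.cons (α := fun _ => Fin d → ℝ) x p) := by
  rw [← hQ (Equiv.Perm.decomposeFin.symm (0, σ)) (Fin.cons (α := fun _ => Fin d → ℝ) x p)]
  congr 1
  ext j : 1
  refine Fin.cases ?_ (fun j => ?_) j <;> simp

/-- Symmetry makes the increasing order in `polarAt` immaterial, so an inserted index may be listed
first wherever it falls. -/
lemma polarAt_eq {Q : (Fin k → Fin d → ℝ) → ℝ}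
    (hQ : ∀ (σ : Equiv.Perm (Fin k)) p, Q (p ∘ σ) = Q p) (a : Fin n → Fin d → ℝ)
    {J : Finset (Fin n)} (hJ : J.card = k) (e : Fin k → Fin n) (he : Function.Injective e)
    (heJ : ∀ j, e j ∈ J) : polarAt Q a J = Q fun j => a (e j) := by
  obtain ⟨σ, hσ⟩ := exists_perm_orderEmbOfFin hJ e he heJ
  rw [polarAt, dif_pos hJ, ← hQ σ]
  congr 1
  ext j : 1
  simp [hσ]

lemma polarAt_insert {Q : (Fin (k + 1) → Fin d → ℝ) → ℝ}
    (hQ : ∀ (σ : Equiv.Perm (Fin (k + 1))) p, Q (p ∘ σ) = Q p) (a : Fin n → Fin d → ℝ)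
    {I : Finset (Fin n)} (hI : I.card = k) {b : Fin n} (hb : b ∉ I) :
    polarAt Q a (insert b I) =
      polarAt (fun p => Q (Fin.cons (α := fun _ => Fin d → ℝ) (a b) p)) a I := by
  have hmem : ∀ j, I.orderEmbOfFin hI j ∈ I := fun j => I.orderEmbOfFin_mem hI j
  rw [polarAt_eq hQ a (by rw [Finset.card_insert_of_notMem hb, hI])
    (Fin.cons (α := fun _ => Fin n) b (I.orderEmbOfFin hI))
    (Fin.cons_injective_iff.2 ⟨fun ⟨j, hj⟩ => hb (hj ▸ hmem j), (I.orderEmbOfFin hI).injective⟩)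
    (fun j => by refine Fin.cases ?_ (fun j => ?_) j <;> simp [hmem]), polarAt, dif_pos hI]
  congr 1
  ext j : 1
  refine Fin.cases ?_ (fun j => ?_) j <;> simp

/-- The polar form at `x` is the affine combination of the polar forms at the `a_b`. -/
lemma sum_mul_polarAt_insert {Q : (Fin (k + 1) → Fin d → ℝ) → ℝ}
    (hQ : ∀ (σ : Equiv.Perm (Fin (k + 1))) p, Q (p ∘ σ) = Q p) (hA : IsMultiaffine Q)
    (a : Fin n → Fin d → ℝ) {I B : Finset (Fin n)} (hI : I.card = k) (hIB : Disjoint I B)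
    {c : Fin n → ℝ} {x : Fin d → ℝ} (hc : ∀ i ∉ B, c i = 0)
    (hcx : ∑ i, c i • projLift (a i) = projLift x) :
    ∑ b ∈ B, c b * polarAt Q a (insert b I) =
      polarAt (fun p => Q (Fin.cons (α := fun _ => Fin d → ℝ) x p)) a I := by
  rw [sum_univ_eq_sum_of_zero_off hc, sum_smul_projLift_eq_projLift_iff] at hcx
  rw [Finset.sum_congr rfl fun b hb => by
    rw [polarAt_insert hQ a hI (Finset.disjoint_right.1 hIB hb)]]
  simp only [polarAt, dif_pos hI]
  have hf := map_sum_smul_of_affine (f := fun y => Q (Fin.cons (α := fun _ => Fin d → ℝ) y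
    fun j => a (I.orderEmbOfFin hI j))) (fun y z s => by
      have := hA (Fin.cons (α := fun _ => Fin d → ℝ) 0 fun j => a (I.orderEmbOfFin hI j)) 0 y z s
      simpa only [Fin.update_cons_zero] using this) B c a hcx.2
  rw [hcx.1] at hf
  exact hf.symm

/-- The function `f` is the diagonal of a multiaffine function of `k` arguments. -/
def IsMultiaffineDiag (d k : ℕ) (f : (Fin d → ℝ) → ℝ) : Prop :=
  ∃ R : (Fin k → Fin d → ℝ) → ℝ, IsMultiaffine R ∧ ∀ x, R (fun _ => x) = f x

lemma isMultiaffineDiag_const (d : ℕ) (r : ℝ) : IsMultiaffineDiag d k fun _ => r :=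
  ⟨fun _ => r, fun _ _ _ _ _ => by ring, fun _ => rfl⟩

lemma IsMultiaffineDiag.mul_coord {f : (Fin d → ℝ) → ℝ} (hf : IsMultiaffineDiag d k f)
    (i : Fin d) : IsMultiaffineDiag d (k + 1) fun x => f x * x i := by
  obtain ⟨R, hR, hRf⟩ := hf
  refine ⟨fun p => R (fun j => p j.succ) * p 0 i, fun p j y z s => ?_, fun x => by
    simp only [hRf]⟩
  refine Fin.cases ?_ (fun j => ?_) j
  · have : ∀ y, (fun j : Fin k => Function.update p 0 y j.succ) = fun j => p j.succ := fun y => by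
      ext j : 1
      rw [Function.update_of_ne (Fin.succ_ne_zero j)]
    simp only [this, Function.update_self, Pi.add_apply, Pi.smul_apply, smul_eq_mul]
    ring
  · have : ∀ y, (fun l : Fin k => Function.update p j.succ y l.succ) =
        Function.update (fun l => p l.succ) j y := fun y => by
      ext l : 1
      simp [Function.update_apply]
    simp only [this, hR (fun l => p l.succ) j y z s,
      Function.update_of_ne (Fin.succ_ne_zero j).symm]
    ring

/-- Each argument supplies one coordinate factor; once the monomial is used up, the remaining
arguments are ignored. -/
lemma isMultiaffineDiag_monomial (d k : ℕ) : ∀ (m : Fin d →₀ ℕ) (r : ℝ), m.degree ≤ k →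
    IsMultiaffineDiag d k fun x => MvPolynomial.eval x (MvPolynomial.monomial m r) := by
  induction k with
  | zero =>
    intro m r hm
    rw [Nat.le_zero, Finsupp.degree_eq_zero_iff] at hm
    simpa [hm] using isMultiaffineDiag_const d r
  | succ k ih =>
    intro m r hm
    by_cases h0 : m = 0
    · simpa [h0] using isMultiaffineDiag_const d r
    obtain ⟨i, hi⟩ := Finsupp.ne_iff.1 h0
    have hle : Finsupp.single i 1 ≤ m := Finsupp.single_le_iff.2 (Nat.one_le_iff_ne_zero.2 hi)
    have hmi : m - Finsupp.single i 1 + Finsupp.single i 1 = m := tsub_add_cancel_of_le hle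
    have hdeg := congrArg Finsupp.degree hmi
    rw [map_add, Finsupp.degree_single] at hdeg
    have := (ih (m - Finsupp.single i 1) r (by omega)).mul_coord i
    convert this using 2 with x
    have hX : MvPolynomial.monomial m r =
        MvPolynomial.monomial (m - Finsupp.single i 1) r * MvPolynomial.X (R := ℝ) i := by
      rw [MvPolynomial.X, MvPolynomial.monomial_mul, mul_one, hmi]
    rw [hX, map_mul, MvPolynomial.eval_X]

lemma isMultiaffineDiag_sum {ι : Type*} (S : Finset ι) (f : ι → (Fin d → ℝ) → ℝ)
    (hf : ∀ i ∈ S, IsMultiaffineDiag d k (f i)) :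
    IsMultiaffineDiag d k fun x => ∑ i ∈ S, f i x := by
  choose! R hR hRf using hf
  refine ⟨fun p => ∑ i ∈ S, R i p, fun p j y z s => ?_,
    fun x => Finset.sum_congr rfl fun i hi => hRf i hi x⟩
  rw [Finset.mul_sum, Finset.mul_sum, ← Finset.sum_add_distrib]
  exact Finset.sum_congr rfl fun i hi => hR i hi p j y z s

/-- Averaging a multiaffine form over permutations of its arguments makes it symmetric and leaves
the diagonal unchanged. -/
theorem exists_isPolarForm (q : MvPolynomial (Fin d) ℝ) (hq : q.totalDegree ≤ k) :
    ∃ Q, IsPolarForm k q Q := by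
  obtain ⟨R, hR, hRq⟩ := isMultiaffineDiag_sum (k := k) q.support
    (fun m x => MvPolynomial.eval x (MvPolynomial.monomial m (q.coeff m)))
    fun m hm => isMultiaffineDiag_monomial d k m _ ((MvPolynomial.le_totalDegree hm).trans hq)
  refine ⟨fun p => (k.factorial : ℝ)⁻¹ * ∑ σ : Equiv.Perm (Fin k), R (p ∘ σ),
    fun τ p => ?_, fun p j y z s => ?_, fun x => ?_⟩
  · congr 1
    exact Fintype.sum_equiv (Equiv.mulLeft τ) _ _ fun σ => rfl
  · simp only [Function.update_comp_equiv, hR _ _ y z s, Finset.sum_add_distrib,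
      ← Finset.mul_sum]
    ring
  · have h1 : ∀ σ : Equiv.Perm (Fin k), R ((fun _ => x) ∘ σ) = MvPolynomial.eval x q := fun σ => by
      have h2 : (fun _ : Fin k => x) ∘ σ = fun _ => x := rfl
      rw [h2, hRq]
      dsimp only
      rw [← map_sum, MvPolynomial.support_sum_monomial_coeff]
    simp only [h1, Finset.sum_const, Finset.card_univ, Fintype.card_perm, Fintype.card_fin,
      nsmul_eq_mul]
    rw [inv_mul_cancel_left₀ (by positivity)]

end Multiaffine

/-! ### Volumes of tiles and negligibility of the knots -/

section Measure
variable {d n : ℕ}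

lemma volume_real_tileSet (a : Fin n → Fin d → ℝ) (I : Finset (Fin n)) {B : Finset (Fin n)}
    (hB : B.card = d + 1) : MeasureTheory.volume.real (tileSet a I B) = detPos a B := by
  have hvol : (Pi.basisFun ℝ (Fin (d + 1))).addHaar = MeasureTheory.volume := by
    rw [Module.Basis.addHaar_eq_iff, Module.Basis.parallelepiped_basisFun,
      ← MeasureTheory.addHaarMeasure_eq_volume_pi]
    exact MeasureTheory.Measure.addHaarMeasure_self
  have hsum : ∑ b ∈ B, segment ℝ 0 (projLift (a b)) =
      parallelepiped fun j => projLift (a (B.orderEmbOfFin hB j)) := by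
    rw [parallelepiped_eq_sum_segment]
    conv_lhs => rw [← Finset.map_orderEmbOfFin_univ B hB, Finset.sum_map]
    rfl
  rw [tileSet, hsum, Set.singleton_add, Set.image_add_left, MeasureTheory.measureReal_def,
    MeasureTheory.measure_preimage_add, ← hvol, MeasureTheory.Measure.addHaar_parallelepiped,
    Pi.basisFun_det, ENNReal.toReal_ofReal (abs_nonneg _), detPos, rowDet, dif_pos hB]
  rfl

lemma volume_knotSet (a : Fin n → Fin d → ℝ) : MeasureTheory.volume (knotSet a) = 0 := by
  refine MeasureTheory.measure_iUnion_null fun C => ?_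
  refine MeasureTheory.measure_mono_null (convexHull_subset_affineSpan _)
    (MeasureTheory.Measure.addHaar_affineSubspace _ _ fun htop => ?_)
  have hr : a '' (C.1 : Set (Fin n)) = Set.range fun i : C.1 => a i := by ext; simp
  -- At most `d` points span directions of dimension at most `card - 1 < d`; the empty set is
  -- separate because of the truncated subtraction.
  rcases Finset.eq_empty_or_nonempty C.1 with h | h
  · rw [h, Finset.coe_empty, Set.image_empty, AffineSubspace.span_empty] at htop
    exact AffineSubspace.bot_ne_top ℝ (Fin d → ℝ) (Fin d → ℝ) htop
  · have hpos := h.card_pos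
    have h1 := finrank_vectorSpan_range_le ℝ (fun i : C.1 => a i) (n := C.1.card - 1)
      (by rw [Fintype.card_coe]; omega)
    rw [← hr, ← direction_affineSpan, htop, AffineSubspace.direction_top, finrank_top,
      Module.finrank_fin_fun] at h1
    have := C.2
    omega

/-- A full-dimensional convex set is in the closure of its interior, where the complement of a null
set is dense. -/
lemma hull_subset_closure_diff_knotSet {a : Fin n → Fin d → ℝ}
    (hspan : affineSpan ℝ (Set.range a) = ⊤) : hull a ⊆ closure (hull a \ knotSet a) := by
  have hconv : Convex ℝ (hull a) := convex_convexHull ℝ _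
  have hint : (interior (hull a)).Nonempty :=
    interior_convexHull_nonempty_iff_affineSpan_eq_top.2 hspan
  have hdense : Dense (knotSet a)ᶜ :=
    MeasureTheory.Measure.dense_of_ae (MeasureTheory.compl_mem_ae_iff.2 (volume_knotSet a))
  calc hull a ⊆ closure (hull a) := subset_closure
    _ = closure (interior (hull a)) :=
      (hconv.closure_interior_eq_closure_of_nonempty_interior hint).symm
    _ ⊆ closure (interior (hull a) ∩ (knotSet a)ᶜ) :=
      closure_minimal (hdense.open_subset_closure_inter isOpen_interior) isClosed_closure
    _ ⊆ closure (hull a \ knotSet a) :=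
      closure_mono (Set.inter_subset_inter_left _ interior_subset)

end Measure

/-! ### The induction on the degree -/

section Reproduction
variable {d n : ℕ} {a : Fin n → Fin d → ℝ} {P : Finset (Finset (Fin n) × Finset (Fin n))}

/-- The tiles at the origin triangulate `ch(A)`. -/
lemma IsFineZonotopalTiling.existsUnique_simplex (hP : IsFineZonotopalTiling a P)
    {x : Fin d → ℝ} (hx : x ∈ hull a) (hxK : x ∉ knotSet a) :
    ∃ t ∈ P, t.1 = ∅ ∧ x ∈ convexHull ℝ (a '' (t.2 : Set (Fin n))) ∧
      ∀ s ∈ P, s.1 = ∅ → x ∈ convexHull ℝ (a '' (s.2 : Set (Fin n))) → s = t := by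
  classical
  have hle : ∀ c : Fin n → ℝ, (∀ i, 0 ≤ c i) → ∑ i, c i • projLift (a i) = projLift x →
      ∀ i, c i ≤ 1 := fun c h0 h i => by
    rw [sum_smul_projLift_eq_projLift_iff] at h
    rw [← h.2]
    exact Finset.single_le_sum (fun i _ => h0 i) (Finset.mem_univ i)
  have hhalf : ∀ c : Fin n → ℝ, ∑ i, c i • projLift (a i) = projLift x →
      ∑ i, ((1 / 2 : ℝ) • c) i • projLift (a i) = (1 / 2 : ℝ) • projLift x := fun c h => by
    rw [← h, Finset.smul_sum]
    simp only [Pi.smul_apply, smul_smul, smul_eq_mul]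
  have hcoord : ∀ t ∈ P, t.1 = ∅ → x ∈ convexHull ℝ (a '' (t.2 : Set (Fin n))) →
      ∃ c : Fin n → ℝ, IsTileCoord t.1 t.2 c ∧ (∀ b ∈ t.2, 0 < c b ∧ c b < 1) ∧
        ∑ i, c i • projLift (a i) = (1 / 2 : ℝ) • projLift x := by
    intro t ht ht1 hxt
    obtain ⟨c, c0, cB, cx⟩ := (mem_convexHull_image_iff a _ x).1 hxt
    have hpos : ∀ b ∈ t.2, 0 < ((1 / 2 : ℝ) • c) b ∧ ((1 / 2 : ℝ) • c) b < 1 := fun b hb => by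
      have h1 := pos_of_notMem_knotSet hxK (hP.tile t ht).2.1 c0 cB cx hb
      have h2 := hle c c0 cx b
      simp only [Pi.smul_apply, smul_eq_mul]
      constructor <;> linarith
    exact ⟨(1 / 2 : ℝ) • c, ⟨by simp [ht1], fun b hb => ⟨(hpos b hb).1.le, (hpos b hb).2.le⟩,
      fun i _ hi => by simp [cB i hi]⟩, hpos, hhalf c cx⟩
  obtain ⟨c, c0, cx⟩ := (mem_hull_iff a x).1 hx
  -- The last coordinate in a tile is at least |I|, so height 1/2 forces `I = ∅`. Halved barycentric
  -- weights also stay below 1, which makes the point interior to its tile.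
  have hZ : (1 / 2 : ℝ) • projLift x ∈ zonotope a := by
    refine (mem_zonotope_iff a _).2 ⟨(1 / 2 : ℝ) • c, fun i => ?_, hhalf c cx⟩
    have h1 := hle c c0 cx i
    have h2 := c0 i
    simp only [Pi.smul_apply, smul_eq_mul]
    constructor <;> linarith
  rw [← hP.cover] at hZ
  obtain ⟨t, ht, hxt⟩ := Set.mem_iUnion₂.1 hZ
  obtain ⟨htd, htB⟩ := hP.tile t ht
  obtain ⟨e, he, hex⟩ := (mem_tileSet_iff a htd _).1 hxt
  have he0 : ∀ i, 0 ≤ e i := fun i => by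
    by_cases h1 : i ∈ t.1
    · rw [he.1 i h1]; exact zero_le_one
    · by_cases h2 : i ∈ t.2
      · exact (he.2.1 i h2).1
      · rw [he.2.2 i h1 h2]
  have ht1 : t.1 = ∅ := by
    by_contra hne
    obtain ⟨i, hi⟩ := Finset.nonempty_iff_ne_empty.2 hne
    have hsum : ∑ i, e i = 1 / 2 := by
      have := congrFun hex (Fin.last d)
      simpa using this
    have := Finset.single_le_sum (f := e) (fun i _ => he0 i) (Finset.mem_univ i)
    rw [he.1 i hi, hsum] at this
    norm_num at this
  have hxt2 : x ∈ convexHull ℝ (a '' (t.2 : Set (Fin n))) := by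
    refine (mem_convexHull_image_iff a _ x).2 ⟨(2 : ℝ) • e, fun i => ?_, fun i hi => ?_, ?_⟩
    · exact mul_nonneg zero_le_two (he0 i)
    · simp [he.2.2 i (by simp [ht1]) hi]
    · have h2 : projLift x = (2 : ℝ) • (1 / 2 : ℝ) • projLift x := by
        rw [smul_smul]; norm_num
      rw [h2, ← hex, Finset.smul_sum]
      simp only [Pi.smul_apply, smul_eq_mul, mul_smul]
  refine ⟨t, ht, ht1, hxt2, fun s hs hs1 hxs => ?_⟩
  obtain ⟨c, hc, hcint, hcx⟩ := hcoord t ht ht1 hxt2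
  obtain ⟨c', hc', -, hcx'⟩ := hcoord s hs hs1 hxs
  refine hP.eq_of_mem_interior hs ht hc hcint ?_
  rw [hcx, ← hcx']
  exact (mem_tileSet_iff a (hP.tile s hs).1 _).2 ⟨c', hc', rfl⟩

/-- The spline expansion of a symmetric multiaffine function reproduces its diagonal. -/
theorem IsFineZonotopalTiling.tileSplineSum_eq (hP : IsFineZonotopalTiling a P)
    {β : Finset (Fin n) → Finset (Fin n)} (hβ : IsBasisChoice a β) {x : Fin d → ℝ}
    (hx : x ∈ hull a) (hxK : x ∉ knotSet a) (k : ℕ)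
    (hrep : ∀ p ∈ (hull a).extremePoints ℝ,
      k + 1 ≤ (Finset.univ.filter (fun i : Fin n => a i = p)).card)
    (Q : (Fin k → Fin d → ℝ) → ℝ) (hQ : ∀ (σ : Equiv.Perm (Fin k)) p, Q (p ∘ σ) = Q p)
    (hA : IsMultiaffine Q) : tileSplineSum a β P k Q x = Q fun _ => x := by
  classical
  induction k with
  | zero =>
    obtain ⟨t, ht, ht1, hxt, huniq⟩ := hP.existsUnique_simplex hx hxK
    have htB := (hP.tile t ht).2
    rw [tileSplineSum, Finset.sum_eq_single t]
    · have hd := (detPos_pos htB).ne'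
      rw [volume_real_tileSet a _ htB.1, ht1, Finset.empty_union, simplexSpline, if_pos htB,
        Set.indicator_of_mem hxt, polarAt, dif_pos Finset.card_empty, zero_add]
      have hQ0 : ∀ p p' : Fin 0 → Fin d → ℝ, Q p = Q p' := fun p p' => by
        rw [Subsingleton.elim p p']
      rw [hQ0 _ fun _ => x]
      have := Nat.factorial_ne_zero d
      field_simp
      simp
    · intro s hs hst
      obtain ⟨hsP, hs0⟩ := Finset.mem_filter.1 hs
      have hs1 := Finset.card_eq_zero.1 hs0
      rw [hs1, Finset.empty_union, simplexSpline, if_pos (hP.tile s hsP).2,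
        Set.indicator_of_notMem fun h => hst (huniq s hsP hs1 h), mul_zero, mul_zero]
    · exact fun h => absurd (Finset.mem_filter.2 ⟨ht, by rw [ht1, Finset.card_empty]⟩) h
  | succ k ih =>
    have hQx : Q (fun _ => x) =
        tileSplineSum a β P k (fun p => Q (Fin.cons (α := fun _ => Fin d → ℝ) x p)) x := by
      rw [ih (fun p hp => (Nat.le_succ _).trans (hrep p hp)) _ (symm_cons_apply hQ x)
        (hA.cons_apply x)]
      congr 1
      ext j : 1
      refine Fin.cases ?_ (fun j => ?_) j <;> simp
    rw [hQx]
    -- The weight of a facet; the adjacent tiles contribute it up to sign.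
    let G : Finset (Fin n) → Finset (Fin n) → ℝ := fun J C =>
      polarAt Q a J * simplexSpline a β k (J ∪ C) x * facetFunctional a C (projLift x)
    have hexch := hP.sum_lower_eq_sum_upper hrep G fun J C h => by
      simp only [G, simplexSpline_eq_zero a β k h, mul_zero, zero_mul]
    have hGsign : ∀ t ∈ P, ∀ b ∈ t.2, ∀ J,
        G J (t.2.erase b) * Real.sign (facetFunctional a (t.2.erase b) (projLift (a b))) =
        polarAt Q a J * simplexSpline a β k (J ∪ t.2.erase b) x * detReplace a t.2 b x := by
      intro t ht b hb J
      have h := detReplace_insert a (C := t.2.erase b) (b := b)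
        (by rw [Finset.card_erase_of_mem hb, (hP.tile t ht).2.1]; rfl) (Finset.notMem_erase _ _) x
      rw [Finset.insert_erase hb] at h
      rw [h]
      ring
    have hlow : ∀ t ∈ P.filter (fun t => t.1.card = k + 1),
        polarAt Q a t.1 * MeasureTheory.volume.real (tileSet a t.1 t.2) *
          simplexSpline a β (k + 1) (t.1 ∪ t.2) x =
        (((k + 1 : ℕ) : ℝ) + d) / ((k + 1 : ℕ) : ℝ) * ∑ b ∈ t.2, G t.1 (t.2.erase b) *
          Real.sign (facetFunctional a (t.2.erase b) (projLift (a b))) := by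
      intro t ht
      obtain ⟨htP, htk⟩ := Finset.mem_filter.1 ht
      obtain ⟨hd, hB⟩ := hP.tile t htP
      obtain ⟨c, hc, hcx⟩ := hB.exists_coord (projLift x)
      rw [volume_real_tileSet a _ hB.1, simplexSpline_succ_eq hβ hxK (X := t.1 ∪ t.2) (c := c)
        (by rw [Finset.card_union_of_disjoint hd, htk, hB.1]; omega)
        (fun i hi => hc i fun h => hi (Finset.mem_union_right _ h)) hcx,
        ← Finset.sum_subset (Finset.subset_univ t.2) fun i _ hi => by rw [hc i hi, zero_mul],
        mul_left_comm, Finset.mul_sum]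
      congr 1
      refine Finset.sum_congr rfl fun b hb => ?_
      rw [hGsign t htP b hb, hB.detReplace_eq hc hcx hb, Finset.erase_union_distrib,
        Finset.erase_eq_of_notMem (Finset.disjoint_right.1 hd hb)]
      ring
    -- Joining `b` to `I` and removing it from `B` leaves `I ∪ B` unchanged, so one spline factors
    -- out and the sum over `b` is the affine expansion of `Q` at `x`.
    have hupp : ∀ t ∈ P.filter (fun t => t.1.card = k),
        ∑ b ∈ t.2, G (insert b t.1) (t.2.erase b) *
          Real.sign (facetFunctional a (t.2.erase b) (projLift (a b))) =
        polarAt (fun p => Q (Fin.cons (α := fun _ => Fin d → ℝ) x p)) a t.1 *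
          MeasureTheory.volume.real (tileSet a t.1 t.2) * simplexSpline a β k (t.1 ∪ t.2) x := by
      intro t ht
      obtain ⟨htP, htk⟩ := Finset.mem_filter.1 ht
      obtain ⟨hd, hB⟩ := hP.tile t htP
      obtain ⟨c, hc, hcx⟩ := hB.exists_coord (projLift x)
      rw [volume_real_tileSet a _ hB.1, ← sum_mul_polarAt_insert hQ hA a htk hd hc hcx,
        Finset.sum_mul, Finset.sum_mul]
      refine Finset.sum_congr rfl fun b hb => ?_
      rw [hGsign t htP b hb, hB.detReplace_eq hc hcx hb, Finset.insert_union,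
        ← Finset.union_insert, Finset.insert_erase hb]
      ring
    rw [tileSplineSum, tileSplineSum, Finset.sum_congr rfl hlow, ← Finset.mul_sum, hexch,
      Finset.sum_congr rfl hupp, ← mul_assoc]
    congr 1
    -- The recurrence factor `(k + 1 + d) / (k + 1)` is exactly the quotient of the two normalizing
    -- constants.
    rw [show k + 1 + d = (k + d) + 1 by ring, Nat.factorial_succ, Nat.factorial_succ]
    have h1 : ((k.factorial : ℕ) : ℝ) ≠ 0 := by positivity
    have h2 : (((k + d).factorial : ℕ) : ℝ) ≠ 0 := by positivity
    have h3 : (k : ℝ) + 1 ≠ 0 := by positivity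
    have h4 : (k : ℝ) + d + 1 ≠ 0 := by positivity
    push_cast
    field_simp
    ring

end Reproduction

theorem corollary1 {d n : ℕ} (a : Fin n → Fin d → ℝ)
    (hspan : affineSpan ℝ (Set.range a) = ⊤)
    (P : Finset (Finset (Fin n) × Finset (Fin n))) (hP : IsFineZonotopalTiling a P)
    (k : ℕ)
    (hrep : ∀ p ∈ (hull a).extremePoints ℝ,
      k + 1 ≤ (Finset.univ.filter (fun i : Fin n => a i = p)).card)
    (β : Finset (Fin n) → Finset (Fin n)) (hβ : IsBasisChoice a β) :
    MeasureTheory.volume (knotSet a) = 0 ∧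
    hull a ⊆ closure (hull a \ knotSet a) ∧
    ∀ q : MvPolynomial (Fin d) ℝ, q.totalDegree ≤ k →
      ∃ Q : (Fin k → Fin d → ℝ) → ℝ, IsPolarForm k q Q ∧
        (∀ x ∈ hull a \ knotSet a,
          MvPolynomial.eval x q = tileSplineSum a β P k Q x) ∧
        (∀ x ∈ hull a,
          Filter.Tendsto (tileSplineSum a β P k Q) (nhdsWithin x (hull a \ knotSet a))
            (nhds (MvPolynomial.eval x q))) := by
  refine ⟨volume_knotSet a, hull_subset_closure_diff_knotSet hspan, fun q hq => ?_⟩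
  obtain ⟨Q, hQ⟩ := exists_isPolarForm q hq
  have heq : ∀ x ∈ hull a \ knotSet a, MvPolynomial.eval x q = tileSplineSum a β P k Q x :=
    fun x hx => by
      rw [hP.tileSplineSum_eq hβ hx.1 hx.2 k hrep Q hQ.symm hQ.affine, hQ.diag]
  refine ⟨Q, hQ, heq, fun x _ => ?_⟩
  have hcont : Filter.Tendsto (fun y => MvPolynomial.eval y q)
      (nhdsWithin x (hull a \ knotSet a)) (nhds (MvPolynomial.eval x q)) :=
    ((MvPolynomial.continuous_eval q).tendsto x).mono_left nhdsWithin_le_nhds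
  exact hcont.congr' (Filter.eventually_of_mem self_mem_nhdsWithin heq)
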